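/- Let $M$ be a (Hausdorff, finite-dimensional) $C^\infty$ manifold with a $C^\infty$ affine connection $\nabla$ (possibly with torsion). Let $\gamma : I \to M$ be a $C^\infty$ curve on an open interval $I$, let $t_0 \in I$ and let $k \ge 1$ be an integer. Put $\nabla^1\gamma = \gamma'$ and $\nabla^{i+1}\gamma = \nabla^\gamma_{\partial/\partial t}(\nabla^i\gamma)$ for $i \ge 1$, where $\nabla^\gamma_{\partial/\partial t}$ is the covariant derivative of vector fields along $\gamma$. Suppose that $(\nabla^i\gamma)(t_0) = 0$ for $1 \le i < k$ and that $(\nabla^k\gamma)(t_0), (\nabla^{k+1}\gamma)(t_0)$ are linearly independent. Then $\gamma$ is directed near $t_0$: there is an open interval $J$ with $t_0 \in J \subseteq I$ and a $C^\infty$ vector field $u$ along $\gamma|_J$ with $u(t) \ne 0$ and $\gamma'(t) \in \langle u(t)\rangle_{\mathbf R}$ for all $t \in J$ (a frame). Moreover, for every such frame $u$ on a neighbourhood of $t_0$, the $\nabla$-tangent surface $$f(t,s) = \varphi(\gamma(t), u(t), s),$$ where $s \mapsto \varphi(x,v,s)$ is the $\nabla$-geodesic with $\varphi(x,v,0)=x$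 and $\frac{\partial\varphi}{\partial s}(x,v,0)=v$, has the following properties. (a) The germ of $f$ at $(t_0,0)$ is a frontal with a non-degenerate singular point at $(t_0,0)$: on a neighbourhood $U$ of $(t_0,0)$ the map $f$ is defined and $C^\infty$, and there are $C^\infty$ vector fields $V_1, V_2$ along $f|_U$, linearly independent at each point, with $f_*(T_q\mathbf R^2) \subseteq \langle V_1(q), V_2(q)\rangle_{\mathbf R}$ for all $q \in U$, such that the $C^\infty$ function $\sigma$ on $U$ determined by $\frac{\partial f}{\partial t}\wedge\frac{\partial f}{\partial s} = \sigma\, V_1 \wedge V_2$ satisfies $\sigma(t_0,0) = 0$ and $d\sigma(t_0,0) \ne 0$. (b) The singular locus $S(f)$, the set of points at which $f$ is not an immersion, coincides with $\{s = 0\}$ on a neighbourhood of $(t_0,0)$. -/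

import Mathlib

open scoped Manifold ContDiff Topology

noncomputable section

namespace TangentSurface

variable {E : Type*} [NormedAddCommGroup E] [NormedSpace ℝ E]
  {M : Type*} [TopologicalSpace M] [ChartedSpace E M] [IsManifold 𝓘(ℝ, E) ∞ M]

/-- An affine connection on `M`: a covariant derivative on the tangent bundle of `M`. In Mathlib's
argument order `cov X x v` is the vector `(∇_v X)(x)`. -/
abbrev AffineConnection (E : Type*) [NormedAddCommGroup E] [NormedSpace ℝ E]
    (M : Type*) [TopologicalSpace M] [ChartedSpace E M] [IsManifold 𝓘(ℝ, E) ∞ M] :=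
  CovariantDerivative 𝓘(ℝ, E) E (TangentSpace 𝓘(ℝ, E) : M → Type _)

/-- The velocity vector `γ'(t) ∈ T_{γ(t)} M` of a curve. -/
def velocity (γ : ℝ → M) (t : ℝ) : TangentSpace 𝓘(ℝ, E) (γ t) :=
  mfderiv 𝓘(ℝ, ℝ) 𝓘(ℝ, E) γ t (1 : ℝ)

/-- The local vector field with constant components `e` in the coordinates of the preferred chart
at `x₀`, that is `∑ eⁱ ∂/∂xⁱ`. (It is set to `0` outside the domain of the chart.) -/
def coordField (x₀ : M) (e : E) (x : M) : TangentSpace 𝓘(ℝ, E) x :=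
  (trivializationAt E (TangentSpace 𝓘(ℝ, E) : M → Type _) x₀).symm x e

/-- The components, in the coordinates of the preferred chart at `x₀`, of a tangent vector. -/
def coordComponents (x₀ : M) {x : M} (v : TangentSpace 𝓘(ℝ, E) x) : E :=
  (trivializationAt E (TangentSpace 𝓘(ℝ, E) : M → Type _) x₀
    (⟨x, v⟩ : TangentBundle 𝓘(ℝ, E) M)).2

/-- The covariant derivative `∇^γ_{∂/∂t} w` of a vector field `w` along a curve `γ`, at the time
`t`, computed in the coordinates of the preferred chart at `x₀` (whose domain has to contain
`γ(t)`): writing `w = ∑ wⁱ ∂ᵢ`, it is `∑ (dwⁱ/dt) ∂ᵢ + ∑ wⁱ(t) ∇_{γ'(t)} ∂ᵢ`, that is, the vector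
with the components `dw^λ/dt + Γ^λ_{μν} (γ')^μ w^ν`. -/
def covDerivAlongInChart (cov : AffineConnection E M) (x₀ : M) (γ : ℝ → M)
    (w : ∀ t : ℝ, TangentSpace 𝓘(ℝ, E) (γ t)) (t : ℝ) : TangentSpace 𝓘(ℝ, E) (γ t) :=
  coordField x₀ (deriv (fun τ : ℝ => coordComponents x₀ (w τ)) t) (γ t)
    + cov (coordField x₀ (coordComponents x₀ (w t))) (γ t) (velocity γ t)

/-- The covariant derivative `∇^γ_{∂/∂t} w` of a vector field `w` along a curve `γ`. It does not
depend on the coordinates; those of the preferred chart at `γ(t)` are used at the time `t`. -/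
def covDerivAlong (cov : AffineConnection E M) (γ : ℝ → M)
    (w : ∀ t : ℝ, TangentSpace 𝓘(ℝ, E) (γ t)) (t : ℝ) : TangentSpace 𝓘(ℝ, E) (γ t) :=
  covDerivAlongInChart cov (γ t) γ w t

/-- The iterated covariant derivatives `∇^k γ` of a curve: `∇^1 γ = γ'` and
`∇^{k+1} γ = ∇^γ_{∂/∂t} (∇^k γ)` for `k ≥ 1`. (The index `0` is not used; its value is `0`.) -/
def iterNabla (cov : AffineConnection E M) (γ : ℝ → M) :
    ℕ → ∀ t : ℝ, TangentSpace 𝓘(ℝ, E) (γ t)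
  | 0 => fun _ => 0
  | 1 => velocity γ
  | k + 2 => covDerivAlong cov γ (iterNabla cov γ (k + 1))

/-- `c` is a `∇`-geodesic on the set `J` (an open interval): it is smooth and `∇² c = 0` there. -/
def IsGeodesicOn (cov : AffineConnection E M) (c : ℝ → M) (J : Set ℝ) : Prop :=
  ContMDiffOn 𝓘(ℝ, ℝ) 𝓘(ℝ, E) ∞ c J ∧ ∀ s ∈ J, iterNabla cov c 2 s = 0

/-- `y` is reached at time `s` by a `∇`-geodesic, defined on an open interval containing `0` and
`s`, which starts at time `0` at the point and with the velocity prescribed by `p = (x, v)`. -/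
def GeodesicReaches (cov : AffineConnection E M) (p : TangentBundle 𝓘(ℝ, E) M) (s : ℝ) (y : M) :
    Prop :=
  ∃ (c : ℝ → M) (J : Set ℝ), IsOpen J ∧ J.OrdConnected ∧ (0 : ℝ) ∈ J ∧ s ∈ J ∧
    IsGeodesicOn cov c J ∧ (⟨c 0, velocity c 0⟩ : TangentBundle 𝓘(ℝ, E) M) = p ∧ c s = y

open Classical in
/-- The family of geodesics `φ(x, v, s)`, with `p = (x, v)`: the point at time `s` of the geodesic
through `x` with the velocity `v` at `s = 0`. Where the geodesic does not exist up to the time `s`,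
the value is set to `x`. -/
def geodesicFamily (cov : AffineConnection E M) (p : TangentBundle 𝓘(ℝ, E) M) (s : ℝ) : M :=
  if h : ∃ y, GeodesicReaches cov p s y then h.choose else p.1

/-- `u` is a frame of a directed structure of the curve `γ` over `J`: a smooth nowhere vanishing
vector field along `γ` such that `γ'(t)` lies in the line spanned by `u(t)`. -/
structure IsDirectedFrameOn (γ : ℝ → M) (u : ∀ t : ℝ, TangentSpace 𝓘(ℝ, E) (γ t))
    (J : Set ℝ) : Prop where
  smooth : ContMDiffOn 𝓘(ℝ, ℝ) 𝓘(ℝ, E).tangent ∞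
    (fun t : ℝ => (⟨γ t, u t⟩ : TangentBundle 𝓘(ℝ, E) M)) J
  ne_zero : ∀ t ∈ J, u t ≠ 0
  integral : ∀ t ∈ J, ∃ a : ℝ, velocity γ t = a • u t

/-- The `∇`-tangent surface `(t, s) ↦ φ(γ(t), u(t), s)` of the curve `γ` directed by `u`. -/
def tangentSurface (cov : AffineConnection E M) (γ : ℝ → M)
    (u : ∀ t : ℝ, TangentSpace 𝓘(ℝ, E) (γ t)) (q : ℝ × ℝ) : M :=
  geodesicFamily cov ⟨γ q.1, u q.1⟩ q.2

/-- The differential `f_* : T_q ℝ² → T_{f(q)} M`. -/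
def surfaceDeriv (f : ℝ × ℝ → M) (q : ℝ × ℝ) : (ℝ × ℝ) →L[ℝ] TangentSpace 𝓘(ℝ, E) (f q) :=
  mfderiv 𝓘(ℝ, ℝ × ℝ) 𝓘(ℝ, E) f q

/-- `V₁, V₂` is a smooth frame over `U` of an integral lifting of `f` to the Grassmannian bundle of
`2`-planes in `TM`: the lifting is `q ↦ ⟨V₁(q), V₂(q)⟩ ⊂ T_{f(q)} M`, and integrality says that the
image of the differential of `f` at `q` is contained in this plane. -/
structure IsIntegralFrameOn (f : ℝ × ℝ → M) (V₁ V₂ : ∀ q : ℝ × ℝ, TangentSpace 𝓘(ℝ, E) (f q))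
    (U : Set (ℝ × ℝ)) : Prop where
  smooth₁ : ContMDiffOn 𝓘(ℝ, ℝ × ℝ) 𝓘(ℝ, E).tangent ∞
    (fun q : ℝ × ℝ => (⟨f q, V₁ q⟩ : TangentBundle 𝓘(ℝ, E) M)) U
  smooth₂ : ContMDiffOn 𝓘(ℝ, ℝ × ℝ) 𝓘(ℝ, E).tangent ∞
    (fun q : ℝ × ℝ => (⟨f q, V₂ q⟩ : TangentBundle 𝓘(ℝ, E) M)) U
  linearIndependent : ∀ q ∈ U, LinearIndependent ℝ ![V₁ q, V₂ q]
  integral : ∀ q ∈ U, ∀ ξ : ℝ × ℝ, surfaceDeriv f q ξ ∈ Submodule.span ℝ {V₁ q, V₂ q}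

/-- `σ` is the signed area density of `f` over `U` with respect to the frame `V₁, V₂`:
`∂f/∂t ∧ ∂f/∂s = σ V₁ ∧ V₂`. -/
def IsAreaDensityOn (f : ℝ × ℝ → M) (V₁ V₂ : ∀ q : ℝ × ℝ, TangentSpace 𝓘(ℝ, E) (f q))
    (σ : ℝ × ℝ → ℝ) (U : Set (ℝ × ℝ)) : Prop :=
  ∀ q ∈ U,
    ExteriorAlgebra.ιMulti ℝ 2 ![surfaceDeriv f q (1, 0), surfaceDeriv f q (0, 1)]
      = σ q • ExteriorAlgebra.ιMulti ℝ 2 ![V₁ q, V₂ q]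

/-- The germ of `f` at `p` is a frontal, i.e. near `p` the map `f` is smooth and has a smooth integral
lifting to the Grassmannian bundle of `2`-planes in `TM`, and `p` is a non-degenerate singular point
of it, i.e. for a frame of the lifting the signed area density `σ` satisfies `σ(p) = 0` and `dσ(p) ≠ 0`. (If this holds for one
frame of one integral lifting, then it holds for all of them.) -/
def IsFrontalWithNondegenerateSingularPointAt (f : ℝ × ℝ → M) (p : ℝ × ℝ) : Prop :=
  ∃ U : Set (ℝ × ℝ), IsOpen U ∧ p ∈ U ∧ ContMDiffOn 𝓘(ℝ, ℝ × ℝ) 𝓘(ℝ, E) ∞ f U ∧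
    ∃ V₁ V₂ : ∀ q : ℝ × ℝ, TangentSpace 𝓘(ℝ, E) (f q), IsIntegralFrameOn f V₁ V₂ U ∧
      ∃ σ : ℝ × ℝ → ℝ, ContDiffOn ℝ ∞ σ U ∧ IsAreaDensityOn f V₁ V₂ σ U ∧
        σ p = 0 ∧ fderiv ℝ σ p ≠ 0

/-- The singular locus `S(f)`: the set of points where `f` is not an immersion. -/
def singularLocus (f : ℝ × ℝ → M) : Set (ℝ × ℝ) :=
  {q | ¬ Function.Injective (surfaceDeriv (E := E) f q)}

end TangentSurface

end

/-! In a chart, covariant differentiation along `γ` becomes D w = w' + B w, where B(t) = Γ(γ(t))(·,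
γ'(t)); here Γ takes the differentiated field first and the direction second. Put m = k - 1. Because
∇^1γ, ..., ∇^mγ vanish at `t₀`, the velocity can be divided m times by t - t₀, so γ' = (t - t₀)^m v
with v smooth. The Leibniz rule then shows that ∇^kγ(t₀) and ∇^{k+1}γ(t₀) are positive multiples of
v(t₀) and (Dv)(t₀). Hence v(t₀) and (Dv)(t₀) are independent, and v is a frame near `t₀`. Any other
frame u satisfies v = b u with b smooth and b(t₀) ≠ 0, and Dv = b' u + b Du, so u(t₀) and (Du)(t₀)
are independent too (`exists_smooth_factor_of_proportional`).

Write γ' = a u, let S(t, s) be the tangent surface in coordinates, and let V = ∂S/∂s be the velocity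
of the geodesics. On s = 0 one has ∂S/∂t = γ' = a u = a V, so Hadamard's lemma gives ∂S/∂t = a V + s
W with W smooth. Differentiating in s at s = 0 and using the geodesic equation gives W = u' + a Γ(u,
u) = u' + Γ(u, γ') = Du. Thus V and W are independent near (t₀, 0) and ∂S/∂t ∧ ∂S/∂s = s W ∧ V: the
area density is s itself, which yields the non-degeneracy and the singular locus at once
(`exists_coordinate_tangentSurface`, `isFrontal_of_coordinates`). Torsion plays no role, since γ' is
a multiple of u and only Γ(u, u) enters.

Two supporting facts are needed. The geodesic flow is jointly smooth in initial data and time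
(`exists_smooth_flow`); this follows from the inverse function theorem on a space of continuous
curves, where superposition operators are smooth. The geodesic with given initial data is unique
(`IsGeodesicOn.eqOn`), so that `geodesicFamily`, defined by a choice, agrees with the coordinate
solution. -/

set_option linter.unusedSectionVars false

noncomputable section

namespace TangentSurface

/-! ### Superposition operators on spaces of continuous maps -/

section Superposition

universe u v

variable {K : Type*} [TopologicalSpace K] [CompactSpace K]
  {F : Type*} [NormedAddCommGroup F] [NormedSpace ℝ F]
  {G : Type*} [NormedAddCommGroup G] [NormedSpace ℝ G]

/-- Pointwise application of a continuous family of operators to a continuous family of vectors,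
as a continuous bilinear map. -/
def pointwiseApply (K F G : Type*) [TopologicalSpace K] [CompactSpace K]
    [NormedAddCommGroup F] [NormedSpace ℝ F] [NormedAddCommGroup G] [NormedSpace ℝ G] :
    C(K, F →L[ℝ] G) →L[ℝ] C(K, F) →L[ℝ] C(K, G) :=
  LinearMap.mkContinuous₂
    (LinearMap.mk₂ ℝ (fun (A : C(K, F →L[ℝ] G)) (β : C(K, F)) =>
        (⟨fun τ => A τ (β τ), A.continuous.clm_apply β.continuous⟩ : C(K, G)))
      (fun A B β => by ext; simp) (fun c A β => by ext; simp)
      (fun A β β' => by ext; simp) (fun c A β => by ext; simp)) 1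
    (fun A β => by
      rw [ContinuousMap.norm_le _ (by positivity)]
      intro τ
      rw [one_mul]
      exact (A τ).le_of_opNorm_le_of_le (A.norm_coe_le_norm τ) (β.norm_coe_le_norm τ))

lemma pointwiseApply_apply (A : C(K, F →L[ℝ] G)) (β : C(K, F)) (τ : K) :
    pointwiseApply K F G A β τ = A τ (β τ) := rfl

open Classical in
/-- The superposition operator `α ↦ f ∘ α`, set to `0` where `f ∘ α` is not continuous. -/
def superpose (f : F → G) (α : C(K, F)) : C(K, G) :=
  if h : Continuous (fun τ => f (α τ)) then ⟨fun τ => f (α τ), h⟩ else 0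

lemma superpose_apply {f : F → G} {Ω : Set F} (hf : ContinuousOn f Ω) {α : C(K, F)}
    (hα : ∀ τ, α τ ∈ Ω) (τ : K) : superpose f α τ = f (α τ) := by
  have h : Continuous (fun τ => f (α τ)) := hf.comp_continuous α.continuous hα
  simp [superpose, h]

lemma isOpen_forall_mem {Ω : Set F} (hΩ : IsOpen Ω) : IsOpen {α : C(K, F) | ∀ τ, α τ ∈ Ω} := by
  simpa [Set.MapsTo] using ContinuousMap.isOpen_setOfPred_mapsTo (X := K) isCompact_univ hΩ

/-- Compactness of `K` makes the continuity of `fderiv ℝ f` uniform along the image of `α`; the mean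
value inequality at each point then bounds the remainder in the supremum norm. -/
lemma hasFDerivAt_superpose {f : F → G} {Ω : Set F} (hΩ : IsOpen Ω) (hf : ContDiffOn ℝ 1 f Ω)
    {α : C(K, F)} (hα : ∀ τ, α τ ∈ Ω) :
    HasFDerivAt (superpose f : C(K, F) → C(K, G))
      (pointwiseApply K F G (superpose (fderiv ℝ f) α)) α := by
  have hd : ContinuousOn (fderiv ℝ f) Ω := hf.continuousOn_fderiv_of_isOpen hΩ le_rfl
  have hdiff : ∀ x ∈ Ω, DifferentiableAt ℝ f x := fun x hx =>
    (hf.differentiableOn one_ne_zero).differentiableAt (hΩ.mem_nhds hx)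
  rw [hasFDerivAt_iff_isLittleO_nhds_zero, Asymptotics.isLittleO_iff]
  intro ε hε
  have key : ∀ᶠ h : F in 𝓝 0, ∀ τ ∈ (Set.univ : Set K),
      α τ + h ∈ Ω ∧ ‖fderiv ℝ f (α τ + h) - fderiv ℝ f (α τ)‖ ≤ ε := by
    apply isCompact_univ.eventually_forall_of_forall_eventually
    intro τ _
    have hc : ContinuousAt (fun z : F × K => α z.2 + z.1) (0, τ) := by fun_prop
    have hc' : ContinuousAt (fun z : F × K => α z.2) (0, τ) := by fun_prop
    have hΩτ : Ω ∈ 𝓝 (α τ) := hΩ.mem_nhds (hα τ)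
    have h1 : ∀ᶠ z : F × K in 𝓝 (0, τ), α z.2 + z.1 ∈ Ω := hc (by simpa using hΩτ)
    have h2 : ContinuousAt (fun z : F × K => fderiv ℝ f (α z.2 + z.1)) (0, τ) :=
      ContinuousAt.comp (f := fun z : F × K => α z.2 + z.1)
        (by simpa using hd.continuousAt hΩτ) hc
    have h3 : ContinuousAt (fun z : F × K => fderiv ℝ f (α z.2)) (0, τ) :=
      ContinuousAt.comp (f := fun z : F × K => α z.2) (by simpa using hd.continuousAt hΩτ) hc'
    have h4 := (h2.sub h3).norm
    have h5 : ∀ᶠ z : F × K in 𝓝 (0, τ),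
        ‖fderiv ℝ f (α z.2 + z.1) - fderiv ℝ f (α z.2)‖ < ε :=
      h4.eventually_lt continuousAt_const (by simpa using hε)
    exact (h1.and h5).mono fun z hz => ⟨hz.1, hz.2.le⟩
  obtain ⟨δ, hδ, hball⟩ := Metric.eventually_nhds_iff_ball.mp key
  filter_upwards [Metric.ball_mem_nhds (0 : C(K, F)) hδ] with β hβ
  have hβτ : ∀ τ, β τ ∈ Metric.ball (0 : F) δ := fun τ => by
    rw [mem_ball_zero_iff] at hβ ⊢
    exact (β.norm_coe_le_norm τ).trans_lt hβ
  rw [ContinuousMap.norm_le _ (by positivity)]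
  intro τ
  have hαβ : ∀ τ, (α + β) τ ∈ Ω := fun τ => (hball _ (hβτ τ) τ (Set.mem_univ _)).1
  rw [ContinuousMap.sub_apply, ContinuousMap.sub_apply, superpose_apply hf.continuousOn hαβ,
    superpose_apply hf.continuousOn hα, pointwiseApply_apply, superpose_apply hd hα]
  have hmem : ∀ x ∈ Metric.ball (α τ) δ, x - α τ ∈ Metric.ball (0 : F) δ := fun x hx => by
    rwa [mem_ball_zero_iff, ← mem_ball_iff_norm]
  have := Convex.norm_image_sub_le_of_norm_fderiv_le' (f := f) (𝕜 := ℝ)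
    (s := Metric.ball (α τ) δ) (C := ε) (x := α τ) (y := α τ + β τ) (φ := fderiv ℝ f (α τ))
    (fun x hx => hdiff x (by simpa using (hball _ (hmem x hx) τ (Set.mem_univ _)).1))
    (fun x hx => by simpa using (hball _ (hmem x hx) τ (Set.mem_univ _)).2)
    (convex_ball _ _) (Metric.mem_ball_self hδ) (by simpa using hβτ τ)
  rw [add_sub_cancel_left] at this
  refine this.trans ?_
  gcongr
  exact β.norm_coe_le_norm τ

/-- The derivative is again a superposition operator, that of `fderiv ℝ f`, followed by a bounded
linear map, so induction applies. The induction changes `G` into `F →L[ℝ] G`; this is why `G` is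
quantified inside and lives in the universe `max u v`. -/
lemma contDiffOn_nat_superpose {F : Type u} [NormedAddCommGroup F] [NormedSpace ℝ F] {Ω : Set F}
    (hΩ : IsOpen Ω) (n : ℕ) : ∀ {G : Type max u v} [NormedAddCommGroup G] [NormedSpace ℝ G]
    {f : F → G}, ContDiffOn ℝ ∞ f Ω →
      ContDiffOn ℝ n (superpose f : C(K, F) → C(K, G)) {α | ∀ τ, α τ ∈ Ω} := by
  induction n with
  | zero =>
    intro G _ _ f hf
    refine contDiffOn_zero.mpr fun α hα => ?_
    exact (hasFDerivAt_superpose hΩ (hf.of_le (by simp)) hα).continuousAt.continuousWithinAt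
  | succ n ih =>
    intro G _ _ f hf
    have hd := fun α (hα : α ∈ {α : C(K, F) | ∀ τ, α τ ∈ Ω}) =>
      hasFDerivAt_superpose hΩ (hf.of_le (by simp)) hα
    rw [Nat.cast_add, Nat.cast_one, contDiffOn_succ_iff_fderiv_of_isOpen (isOpen_forall_mem hΩ)]
    refine ⟨fun α hα => (hd α hα).differentiableAt.differentiableWithinAt, by simp, ?_⟩
    have hf' : ContDiffOn ℝ ∞ (fderiv ℝ f) Ω :=
      ((contDiffOn_infty_iff_fderiv_of_isOpen hΩ).mp hf).2
    have hc : ContDiff ℝ n (pointwiseApply K F G) := ContinuousLinearMap.contDiff _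
    exact (hc.comp_contDiffOn (ih hf')).congr fun α hα => (hd α hα).fderiv

lemma contDiffOn_superpose {F : Type u} [NormedAddCommGroup F] [NormedSpace ℝ F] {Ω : Set F}
    (hΩ : IsOpen Ω) {G : Type max u v} [NormedAddCommGroup G] [NormedSpace ℝ G]
    {f : F → G} (hf : ContDiffOn ℝ ∞ f Ω) :
    ContDiffOn ℝ ∞ (superpose f : C(K, F) → C(K, G)) {α | ∀ τ, α τ ∈ Ω} :=
  contDiffOn_infty.mpr fun n => contDiffOn_nat_superpose.{u, v} hΩ n hf

end Superposition

/-! ### Primitives of continuous maps on `[-1, 1]` -/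

section Primitive

variable {F : Type*} [NormedAddCommGroup F] [NormedSpace ℝ F]

/-- The symmetric unit interval `[-1, 1]`. -/
abbrev SymmInterval : Type := Set.Icc (-1 : ℝ) 1

/-- The extension of a continuous map on `[-1, 1]` to the real line, constant on both sides. -/
def extendMap (α : C(SymmInterval, F)) : ℝ → F := Set.IccExtend (by norm_num) α

lemma continuous_extendMap (α : C(SymmInterval, F)) : Continuous (extendMap α) :=
  α.continuous.Icc_extend'

lemma extendMap_of_mem (α : C(SymmInterval, F)) {τ : ℝ} (hτ : τ ∈ Set.Icc (-1 : ℝ) 1) :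
    extendMap α τ = α ⟨τ, hτ⟩ := Set.IccExtend_of_mem _ _ hτ

lemma norm_extendMap_le (α : C(SymmInterval, F)) (τ : ℝ) : ‖extendMap α τ‖ ≤ ‖α‖ :=
  α.norm_coe_le_norm _

/-- The primitive `τ ↦ ∫_0^τ α` of a continuous map on `[-1, 1]`, as a continuous linear map. -/
def primitive (F : Type*) [NormedAddCommGroup F] [NormedSpace ℝ F] :
    C(SymmInterval, F) →L[ℝ] C(SymmInterval, F) :=
  LinearMap.mkContinuous
    { toFun := fun α => ⟨fun τ => ∫ x in (0 : ℝ)..τ, extendMap α x,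
        (intervalIntegral.continuous_primitive
          (fun a b => (continuous_extendMap α).intervalIntegrable a b) 0).comp
            continuous_subtype_val⟩
      map_add' := fun α β => by
        ext τ
        exact intervalIntegral.integral_add ((continuous_extendMap α).intervalIntegrable _ _)
          ((continuous_extendMap β).intervalIntegrable _ _)
      map_smul' := fun c α => by
        ext τ
        exact intervalIntegral.integral_smul c _ } 1
    (fun α => by
      rw [ContinuousMap.norm_le _ (by positivity)]
      intro τ
      have h := intervalIntegral.norm_integral_le_of_norm_le_const (a := 0) (b := (τ : ℝ))
        (f := extendMap α) (C := ‖α‖) (fun x _ => norm_extendMap_le α x)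
      refine h.trans ?_
      rw [one_mul]
      refine mul_le_of_le_one_right (norm_nonneg _) ?_
      rw [sub_zero, abs_le]
      exact τ.2)

lemma primitive_apply (α : C(SymmInterval, F)) (τ : SymmInterval) :
    primitive F α τ = ∫ x in (0 : ℝ)..τ, extendMap α x := rfl

end Primitive

/-! ### Division by a coordinate -/

section Division

variable {E : Type*} [NormedAddCommGroup E] [NormedSpace ℝ E] [CompleteSpace E]

/-- The segment `τ ↦ (t, τ s)`, depending linearly on `(t, s)`. -/
def verticalSegment : (ℝ × ℝ) →L[ℝ] C(SymmInterval, ℝ × ℝ) :=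
  LinearMap.toContinuousLinearMap
    { toFun := fun q => ⟨fun τ => (q.1, τ * q.2), by fun_prop⟩
      map_add' := fun p q => by ext τ <;> simp [mul_add]
      map_smul' := fun c q => by ext τ <;> simp [mul_left_comm] }

lemma verticalSegment_apply (q : ℝ × ℝ) (τ : SymmInterval) :
    verticalSegment q τ = (q.1, τ * q.2) := rfl

lemma mul_mem_Ioo {r s τ : ℝ} (hτ : τ ∈ Set.Icc (-1 : ℝ) 1) (hs : s ∈ Set.Ioo (-r) r) :
    τ * s ∈ Set.Ioo (-r) r := by
  rw [Set.mem_Ioo, ← abs_lt] at hs ⊢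
  rw [abs_mul]
  exact (mul_le_of_le_one_left (abs_nonneg s) (abs_le.mpr hτ)).trans_lt hs

/-- Hadamard's lemma: a smooth function of `(t, s)` vanishing on `s = 0` is a smooth multiple of
`s`. -/
lemma exists_eq_smul_of_eq_zero {A : Set ℝ} (hA : IsOpen A) {r : ℝ}
    {G : ℝ × ℝ → E} (hG : ContDiffOn ℝ ∞ G (A ×ˢ Set.Ioo (-r) r)) (h0 : ∀ t ∈ A, G (t, 0) = 0) :
    ∃ W : ℝ × ℝ → E, ContDiffOn ℝ ∞ W (A ×ˢ Set.Ioo (-r) r) ∧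
      ∀ q ∈ A ×ˢ Set.Ioo (-r) r, G q = q.2 • W q := by
  set Ω : Set (ℝ × ℝ) := A ×ˢ Set.Ioo (-r) r with hΩdef
  have hΩ : IsOpen Ω := hA.prod isOpen_Ioo
  set H : ℝ × ℝ → E := fun q => fderiv ℝ G q (0, 1) with hHdef
  have hH : ContDiffOn ℝ ∞ H Ω :=
    ((contDiffOn_infty_iff_fderiv_of_isOpen hΩ).mp hG).2.clm_apply contDiffOn_const
  have hseg : ∀ q ∈ Ω, ∀ τ, verticalSegment q τ ∈ Ω := fun q hq τ =>
    ⟨hq.1, mul_mem_Ioo τ.2 hq.2⟩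
  have h1 : (1 : ℝ) ∈ Set.Icc (-1 : ℝ) 1 := by norm_num
  -- The quotient is ∫_0^1 (∂G/∂s)(t, τ s) dτ. Written as a superposition operator between bounded
  -- linear maps, it is smooth without differentiating under the integral sign.
  refine ⟨fun q => primitive E (superpose H (verticalSegment q)) ⟨1, h1⟩, ?_, ?_⟩
  · have hc : ContDiff ℝ ∞ ((ContinuousMap.evalCLM ℝ (⟨1, h1⟩ : SymmInterval)).comp
      (primitive E)) := ContinuousLinearMap.contDiff _
    exact hc.comp_contDiffOn ((contDiffOn_superpose hΩ hH).comp
      verticalSegment.contDiff.contDiffOn hseg)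
  · intro q hq
    have hder : ∀ x ∈ Set.uIcc (0 : ℝ) 1,
        HasDerivAt (fun x : ℝ => G (q.1, x * q.2))
          (q.2 • extendMap (superpose H (verticalSegment q)) x) x := by
      intro x hx
      rw [Set.uIcc_of_le zero_le_one] at hx
      have hx' : x ∈ Set.Icc (-1 : ℝ) 1 := ⟨by linarith [hx.1], hx.2⟩
      rw [extendMap_of_mem _ hx', superpose_apply hH.continuousOn (hseg q hq),
        verticalSegment_apply]
      have hmem : (q.1, x * q.2) ∈ Ω := hseg q hq ⟨x, hx'⟩
      have hGd := ((hG.differentiableOn (by simp)).differentiableAt (hΩ.mem_nhds hmem)).hasFDerivAt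
      have hl : HasDerivAt (fun x : ℝ => ((q.1, x * q.2) : ℝ × ℝ)) ((0, q.2) : ℝ × ℝ) x := by
        simpa using (hasDerivAt_const x q.1).prodMk ((hasDerivAt_id x).mul_const q.2)
      have := hGd.comp_hasDerivAt x hl
      have he : ((0, q.2) : ℝ × ℝ) = q.2 • ((0, 1) : ℝ × ℝ) := by simp
      rw [he, ContinuousLinearMap.map_smul] at this
      exact this
    have hint := intervalIntegral.integral_eq_sub_of_hasDerivAt hder
      (((continuous_extendMap _).const_smul q.2).intervalIntegrable _ _)
    rw [intervalIntegral.integral_smul] at hint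
    simp only [one_mul, zero_mul, h0 q.1 hq.1, sub_zero] at hint
    exact hint.symm

/-- A smooth function of one variable vanishing at `t₀` is a smooth multiple of `t - t₀`. -/
lemma exists_eq_sub_smul_of_eq_zero {t₀ r : ℝ} {g : ℝ → E}
    (hg : ContDiffOn ℝ ∞ g (Set.Ioo (t₀ - r) (t₀ + r))) (h0 : g t₀ = 0) :
    ∃ v : ℝ → E, ContDiffOn ℝ ∞ v (Set.Ioo (t₀ - r) (t₀ + r)) ∧
      ∀ t ∈ Set.Ioo (t₀ - r) (t₀ + r), g t = (t - t₀) • v t := by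
  -- The two-variable statement, with a dummy first variable.
  obtain ⟨W, hW, hGW⟩ := exists_eq_smul_of_eq_zero (A := Set.univ) (r := r) isOpen_univ
    (G := fun q => g (t₀ + q.2))
    (hg.comp (by fun_prop) fun q hq => ⟨by linarith [hq.2.1], by linarith [hq.2.2]⟩)
    (fun t _ => by simpa using h0)
  have hm : ∀ t ∈ Set.Ioo (t₀ - r) (t₀ + r),
      ((0 : ℝ), t - t₀) ∈ (Set.univ : Set ℝ) ×ˢ Set.Ioo (-r) r :=
    fun t ht => ⟨Set.mem_univ _, by linarith [ht.1], by linarith [ht.2]⟩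
  exact ⟨fun t => W (0, t - t₀), hW.comp (by fun_prop) hm,
    fun t ht => by simpa using hGW _ (hm t ht)⟩

end Division

/-! ### Smooth dependence of solutions of ODEs on the initial condition -/

section Flow

variable {F : Type*} [NormedAddCommGroup F] [NormedSpace ℝ F] [CompleteSpace F]

/-- Constant maps, as a continuous linear map. -/
def constMap (F : Type*) [NormedAddCommGroup F] [NormedSpace ℝ F] :
    F →L[ℝ] C(SymmInterval, F) :=
  LinearMap.mkContinuous
    { toFun := fun y => ContinuousMap.const _ y
      map_add' := fun _ _ => rfl
      map_smul' := fun _ _ => rfl } 1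
    (fun y => by
      rw [ContinuousMap.norm_le _ (by positivity)]
      exact fun τ => (one_mul ‖y‖).ge)

lemma constMap_apply (y : F) (τ : SymmInterval) : constMap F y τ = y := rfl

/-- The map `(y, s, α) ↦ (y, s, α - y - s ∫ X(α))`, whose fibres over the points `(y, s, 0)` are
the solutions of `α' = s X(α)` with the initial value `y`. -/
def picardDefect (X : F → F) (p : (F × ℝ) × C(SymmInterval, F)) :
    (F × ℝ) × C(SymmInterval, F) :=
  (p.1, p.2 - constMap F p.1.1 - p.1.2 • primitive F (superpose X p.2))

lemma contDiffOn_picardDefect {X : F → F} {Ω : Set F} (hΩ : IsOpen Ω)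
    (hX : ContDiffOn ℝ ∞ X Ω) :
    ContDiffOn ℝ ∞ (picardDefect X) (Set.univ ×ˢ {α | ∀ τ, α τ ∈ Ω}) := by
  have h1 : ContDiffOn ℝ ∞ (fun p : (F × ℝ) × C(SymmInterval, F) => superpose X p.2)
      (Set.univ ×ˢ {α | ∀ τ, α τ ∈ Ω}) :=
    (contDiffOn_superpose hΩ hX).comp contDiff_snd.contDiffOn fun p hp => hp.2
  have h2 := ((primitive F).contDiff (n := ∞)).comp_contDiffOn h1
  have h3 : ContDiff ℝ ∞ (fun p : (F × ℝ) × C(SymmInterval, F) => p.2 - constMap F p.1.1) :=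
    contDiff_snd.sub ((constMap F).contDiff.comp (contDiff_fst.comp contDiff_fst))
  exact contDiff_fst.contDiffOn.prodMk
    (h3.contDiffOn.sub ((contDiff_snd.comp contDiff_fst).contDiffOn.smul h2))

/-- At s = 0 the factor s kills the derivative of the superposition operator. What remains is block
triangular, (η, β) ↦ (η, β - B η), with inverse (η, β) ↦ (η, β + B η). -/
lemma exists_hasFDerivAt_picardDefect {X : F → F} {Ω : Set F} (hΩ : IsOpen Ω)
    (hX : ContDiffOn ℝ ∞ X Ω) {y₀ : F} (hy₀ : y₀ ∈ Ω) :
    ∃ L : ((F × ℝ) × C(SymmInterval, F)) ≃L[ℝ] ((F × ℝ) × C(SymmInterval, F)),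
      HasFDerivAt (picardDefect X) (L : _ →L[ℝ] _) ((y₀, 0), constMap F y₀) := by
  set P := (F × ℝ) × C(SymmInterval, F)
  set c : C(SymmInterval, F) := primitive F (superpose X (constMap F y₀)) with hc
  have hsup : HasFDerivAt (superpose X : C(SymmInterval, F) → _) _ (constMap F y₀) :=
    hasFDerivAt_superpose hΩ (hX.of_le (by simp)) (fun _ => hy₀)
  have hfst : HasFDerivAt (fun p : P => p.1) (ContinuousLinearMap.fst ℝ _ _)
    ((y₀, 0), constMap F y₀) := hasFDerivAt_fst
  have hsnd : HasFDerivAt (fun p : P => p.2) (ContinuousLinearMap.snd ℝ _ _)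
    ((y₀, 0), constMap F y₀) := hasFDerivAt_snd
  have hs : HasFDerivAt (fun p : P => p.1.2)
    ((ContinuousLinearMap.snd ℝ F ℝ).comp (ContinuousLinearMap.fst ℝ _ _))
    ((y₀, 0), constMap F y₀) := hfst.snd
  have hy : HasFDerivAt (fun p : P => p.1.1)
    ((ContinuousLinearMap.fst ℝ F ℝ).comp (ContinuousLinearMap.fst ℝ _ _))
    ((y₀, 0), constMap F y₀) := hfst.fst
  have hprim := (primitive F).hasFDerivAt.comp ((y₀, 0), constMap F y₀)
    (HasFDerivAt.comp ((y₀, 0), constMap F y₀) (f := fun p : P => p.2) hsup hsnd)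
  have hder := hfst.prodMk ((hsnd.sub ((constMap F).hasFDerivAt.comp _ hy)).sub (hs.smul hprim))
  let B : (F × ℝ) →L[ℝ] C(SymmInterval, F) :=
    (constMap F).comp (ContinuousLinearMap.fst ℝ F ℝ)
      + (ContinuousLinearMap.snd ℝ F ℝ).smulRight c
  let L₁ : P →L[ℝ] P := (ContinuousLinearMap.fst ℝ _ _).prod
    (ContinuousLinearMap.snd ℝ _ _ - B.comp (ContinuousLinearMap.fst ℝ _ _))
  let L₂ : P →L[ℝ] P := (ContinuousLinearMap.fst ℝ _ _).prod
    (ContinuousLinearMap.snd ℝ _ _ + B.comp (ContinuousLinearMap.fst ℝ _ _))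
  refine ⟨ContinuousLinearEquiv.equivOfInverse L₁ L₂ (fun p => by simp [L₁, L₂])
    (fun p => by simp [L₁, L₂]), ?_⟩
  refine hder.congr_fderiv ?_
  ext1
  · ext p <;> simp [L₁, B, c]
  · ext p <;> simp [L₁, B, c]

/-- Multiplication by a number in `[-1, 1]`, as a map of `[-1, 1]` to itself. -/
def rescale (τ : SymmInterval) : C(SymmInterval, SymmInterval) :=
  ⟨fun x => ⟨τ * x, abs_le.mp (by
    rw [abs_mul]
    exact mul_le_one₀ (abs_le.mpr τ.2) (abs_nonneg _) (abs_le.mpr x.2))⟩, by fun_prop⟩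

lemma rescale_coe (τ x : SymmInterval) : (rescale τ x : ℝ) = τ * x := rfl

/-- If α' = s X(α), then x ↦ α(τ x) solves the same equation with τ s in place of s; in integral
form this is a linear change of variables. -/
lemma picardDefect_rescale {X : F → F} {Ω : Set F} (hX : ContinuousOn X Ω) {y : F} {s : ℝ}
    {α : C(SymmInterval, F)} (hα : ∀ τ, α τ ∈ Ω)
    (h : picardDefect X ((y, s), α) = ((y, s), 0)) (τ : SymmInterval) :
    picardDefect X ((y, τ * s), α.comp (rescale τ)) = ((y, τ * s), 0) := by
  have h2 : α - constMap F y - s • primitive F (superpose X α) = 0 := congrArg Prod.snd h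
  refine Prod.ext rfl (ContinuousMap.ext fun x => ?_)
  have h3 := congrArg (fun β : C(SymmInterval, F) => β (rescale τ x)) h2
  have hint : (τ : ℝ) • ∫ z in (0 : ℝ)..x, extendMap (superpose X (α.comp (rescale τ))) z
      = ∫ z in (0 : ℝ)..(τ * x : ℝ), extendMap (superpose X α) z := by
    have hcv := intervalIntegral.smul_integral_comp_mul_left (a := 0) (b := (x : ℝ))
      (f := extendMap (superpose X α)) (τ : ℝ)
    rw [mul_zero] at hcv
    rw [← hcv]
    congr 1
    refine intervalIntegral.integral_congr fun z hz => ?_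
    have hz' : z ∈ Set.Icc (-1 : ℝ) 1 :=
      (Set.uIcc_subset_Icc (by norm_num) x.2) hz
    have hzr : (τ : ℝ) * z ∈ Set.Icc (-1 : ℝ) 1 := (rescale τ ⟨z, hz'⟩).2
    change extendMap (superpose X (α.comp (rescale τ))) z = extendMap (superpose X α) (τ * z)
    rw [extendMap_of_mem _ hz', extendMap_of_mem _ hzr, superpose_apply hX hα,
      superpose_apply hX (α := α.comp (rescale τ)) (fun _ => hα _)]
    rfl
  simp only [picardDefect, ContinuousMap.sub_apply, ContinuousMap.smul_apply, constMap_apply,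
    ContinuousMap.comp_apply, primitive_apply, ContinuousMap.zero_apply, rescale_coe] at h3 ⊢
  rw [mul_comm, mul_smul, hint]
  exact h3

/-- A smooth vector field has a local flow which is smooth jointly in the initial condition and
the time. -/
lemma exists_smooth_flow {X : F → F} {Ω : Set F} (hΩ : IsOpen Ω) (hX : ContDiffOn ℝ ∞ X Ω)
    {y₀ : F} (hy₀ : y₀ ∈ Ω) :
    ∃ r > 0, ∃ Φ : F × ℝ → F, ContDiffOn ℝ ∞ Φ (Metric.ball y₀ r ×ˢ Set.Ioo (-r) r) ∧
      (∀ y ∈ Metric.ball y₀ r, Φ (y, 0) = y) ∧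
      ∀ y ∈ Metric.ball y₀ r, ∀ s ∈ Set.Ioo (-r) r,
        Φ (y, s) ∈ Ω ∧ HasDerivAt (fun s => Φ (y, s)) (X (Φ (y, s))) s := by
  set D : Set ((F × ℝ) × C(SymmInterval, F)) := Set.univ ×ˢ {α | ∀ τ, α τ ∈ Ω} with hD
  have hDopen : IsOpen D := isOpen_univ.prod (isOpen_forall_mem hΩ)
  have hsmooth := contDiffOn_picardDefect hΩ hX
  set p₀ : (F × ℝ) × C(SymmInterval, F) := ((y₀, 0), constMap F y₀) with hp₀
  have hp₀D : p₀ ∈ D := ⟨Set.mem_univ _, fun _ => hy₀⟩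
  have hat : ∀ p ∈ D, ContDiffAt ℝ ∞ (picardDefect X) p := fun p hp =>
    hsmooth.contDiffAt (hDopen.mem_nhds hp)
  obtain ⟨L, hL⟩ := exists_hasFDerivAt_picardDefect hΩ hX hy₀
  -- Time enters as the parameter s, so all solutions live on the fixed interval [-1, 1], and
  -- inverting `picardDefect X` solves the equation for all (y, s) near (y₀, 0).
  let e := (hat p₀ hp₀D).toOpenPartialHomeomorph _ hL (by simp)
  have hecoe : ∀ p, e p = picardDefect X p := fun p => rfl
  have hp₀e : p₀ ∈ e.source := (hat p₀ hp₀D).mem_toOpenPartialHomeomorph_source hL (by simp)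
  have hHp₀ : e p₀ = ((y₀, 0), 0) := by
    rw [hecoe]
    simp [picardDefect, hp₀]
  have hfd : ContinuousAt (fderiv ℝ (picardDefect X)) p₀ :=
    (hsmooth.continuousOn_fderiv_of_isOpen hDopen (by simp)).continuousAt
      (hDopen.mem_nhds hp₀D)
  -- Smoothness of the inverse is wanted at all points near the base point, so the derivative has to
  -- be invertible at each of them; invertible operators form an open set.
  have hgood : ∀ᶠ p in 𝓝 p₀, p ∈ e.source ∧ p ∈ D ∧ fderiv ℝ (picardDefect X) p ∈
      Set.range (ContinuousLinearEquiv.toContinuousLinearMap (σ₁₂ := RingHom.id ℝ)) := by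
    have hinv := hfd.eventually_mem (hL.fderiv ▸ L.nhds)
    filter_upwards [e.open_source.mem_nhds hp₀e, hDopen.mem_nhds hp₀D, hinv] with p h₁ h₂ h₃
    exact ⟨h₁, h₂, h₃⟩
  obtain ⟨ρ, hρ, hball⟩ := Metric.eventually_nhds_iff_ball.mp hgood
  set z : F × ℝ → (F × ℝ) × C(SymmInterval, F) := fun p => e.symm (p, 0) with hz
  have htgt : ((y₀, 0), 0) ∈ e.target := hHp₀ ▸ e.map_source hp₀e
  have hz₀ : z (y₀, 0) = p₀ := by
    rw [hz]
    change e.symm ((y₀, 0), 0) = p₀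
    rw [← hHp₀, e.left_inv hp₀e]
  have hι : ContinuousAt (fun p : F × ℝ => (p, (0 : C(SymmInterval, F)))) (y₀, 0) := by fun_prop
  have hzc : ContinuousAt z (y₀, 0) :=
    ContinuousAt.comp (f := fun p : F × ℝ => (p, (0 : C(SymmInterval, F))))
      (e.continuousAt_symm htgt) hι
  have hev : ∀ᶠ p in 𝓝 (y₀, (0 : ℝ)), (p, (0 : C(SymmInterval, F))) ∈ e.target ∧
      z p ∈ Metric.ball p₀ ρ := by
    have hzb := hzc.eventually_mem (Metric.ball_mem_nhds _ hρ)
    rw [hz₀] at hzb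
    filter_upwards [hι.eventually_mem (e.open_target.mem_nhds htgt), hzb] with p h₁ h₂
    exact ⟨h₁, h₂⟩
  obtain ⟨r, hr, hN⟩ := Metric.eventually_nhds_iff_ball.mp hev
  have hNr : ∀ y ∈ Metric.ball y₀ r, ∀ s ∈ Set.Ioo (-r) r,
      (y, s) ∈ Metric.ball (y₀, (0 : ℝ)) r := by
    intro y hy s hs
    rw [← ball_prod_same]
    exact ⟨hy, by rwa [mem_ball_zero_iff, Real.norm_eq_abs, abs_lt]⟩
  have hez : ∀ p ∈ Metric.ball (y₀, (0 : ℝ)) r, picardDefect X (z p) = (p, 0) := fun p hp =>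
    e.right_inv (hN p hp).1
  have hz1 : ∀ p ∈ Metric.ball (y₀, (0 : ℝ)) r, (z p).1 = p := fun p hp =>
    congrArg Prod.fst (hez p hp)
  have hzpair : ∀ p ∈ Metric.ball (y₀, (0 : ℝ)) r, z p = (p, (z p).2) := fun p hp =>
    Prod.ext (hz1 p hp) rfl
  have hzΩ : ∀ p ∈ Metric.ball (y₀, (0 : ℝ)) r, ∀ τ, (z p).2 τ ∈ Ω := fun p hp =>
    (hball _ (hN p hp).2).2.1.2
  have hzsmooth : ContDiffOn ℝ ∞ z (Metric.ball (y₀, (0 : ℝ)) r) := by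
    intro p hp
    obtain ⟨htp, hbp⟩ := hN p hp
    obtain ⟨-, hDp, L', hL'⟩ := hball _ hbp
    have hd : HasFDerivAt e (L' : _ →L[ℝ] _) (e.symm (p, 0)) := by
      rw [hL']
      exact ((hat _ hDp).differentiableAt (by simp)).hasFDerivAt
    have := e.contDiffAt_symm htp hd (hat _ hDp)
    exact (ContDiffAt.comp (f := fun p : F × ℝ => (p, (0 : C(SymmInterval, F)))) p this
      (by fun_prop)).contDiffWithinAt
  have h1 : (1 : ℝ) ∈ Set.Icc (-1 : ℝ) 1 := by norm_num
  set one : SymmInterval := ⟨1, h1⟩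
  -- The rescaled solution stays in the ball on which `e` is injective, so it is the solution
  -- selected by `z` for the time τ s. This turns the parameter s into actual time.
  have hscale : ∀ y s, (y, s) ∈ Metric.ball (y₀, (0 : ℝ)) r → ∀ τ : SymmInterval,
      (z (y, τ * s)).2 one = (z (y, s)).2 τ := by
    intro y s hys τ
    have hfix := picardDefect_rescale hX.continuousOn (hzΩ _ hys)
      (by rw [← hzpair _ hys]; exact hez _ hys) τ
    have hmem : ((y, τ * s), (z (y, s)).2.comp (rescale τ)) ∈ Metric.ball p₀ ρ := by
      have hb := (hN _ hys).2
      rw [hzpair _ hys, hp₀, ← ball_prod_same, ← ball_prod_same] at hb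
      rw [hp₀, ← ball_prod_same, ← ball_prod_same]
      obtain ⟨⟨hb1, hb2⟩, hb3⟩ := hb
      refine ⟨⟨hb1, ?_⟩, ?_⟩
      · rw [mem_ball_zero_iff, Real.norm_eq_abs] at hb2 ⊢
        exact abs_lt.mpr (mul_mem_Ioo τ.2 (abs_lt.mp hb2))
      · rw [Metric.mem_ball, ContinuousMap.dist_lt_iff hρ] at hb3 ⊢
        exact fun x => hb3 (rescale τ x)
    have hzeq : z (y, τ * s) = ((y, τ * s), (z (y, s)).2.comp (rescale τ)) := by
      change e.symm ((y, τ * s), 0) = _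
      rw [← hfix, ← hecoe, e.left_inv (hball _ hmem).1]
    rw [hzeq]
    change (z (y, s)).2 (rescale τ one) = _
    congr 1
    exact Subtype.ext (mul_one _)
  refine ⟨r, hr, fun p => (z p).2 one, ?_, ?_, ?_⟩
  · have hc : ContDiff ℝ ∞ (ContinuousMap.evalCLM ℝ one : C(SymmInterval, F) →L[ℝ] F) :=
      ContinuousLinearMap.contDiff _
    exact hc.comp_contDiffOn
      (contDiff_snd.comp_contDiffOn (hzsmooth.mono fun p hp => hNr _ hp.1 _ hp.2))
  · intro y hy
    have hp := hNr y hy 0 ⟨by linarith, hr⟩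
    have h2 := congrArg (fun q => q.2 one) (hez _ hp)
    have h3 := hz1 _ hp
    simp only [picardDefect, h3] at h2
    simpa [constMap_apply, sub_eq_zero] using h2
  · intro y hy s hs
    refine ⟨hzΩ _ (hNr y hy s hs) _, ?_⟩
    -- For s' near s, Φ(y, s') = α(s'/s₁) with the single curve α belonging to s₁; since |s| < s₁,
    -- the point s/s₁ is interior to [-1, 1] and α can be differentiated there.
    obtain ⟨s₁, hs₁, hs₁r⟩ := exists_between (abs_lt.mpr hs)
    have hs₁0 : 0 < s₁ := (abs_nonneg s).trans_lt hs₁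
    have hp₁ := hNr y hy s₁ ⟨by linarith, hs₁r⟩
    set α := (z (y, s₁)).2 with hα
    have hval : ∀ s', |s'| < s₁ → ∃ hτ : s' / s₁ ∈ Set.Icc (-1 : ℝ) 1,
        (z (y, s')).2 one = α ⟨s' / s₁, hτ⟩ := by
      intro s' hs'
      have hτ : s' / s₁ ∈ Set.Icc (-1 : ℝ) 1 := by
        rw [Set.mem_Icc, ← abs_le, abs_div, abs_of_pos hs₁0, div_le_one hs₁0]
        exact hs'.le
      refine ⟨hτ, ?_⟩
      have := hscale y s₁ hp₁ ⟨s' / s₁, hτ⟩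
      rwa [div_mul_cancel₀ _ hs₁0.ne'] at this
    have hformula : ∀ τ : SymmInterval,
        α τ = y + s₁ • ∫ x in (0 : ℝ)..τ, extendMap (superpose X α) x := by
      intro τ
      have h2 := congrArg (fun q => q.2 τ) (hez _ hp₁)
      have h3 := hz1 _ hp₁
      simp only [picardDefect, h3] at h2
      simpa [constMap_apply, primitive_apply, sub_sub, sub_eq_zero] using h2
    have hcont := continuous_extendMap (superpose X α)
    have hd : HasDerivAt (fun s' : ℝ => y + s₁ • ∫ x in (0 : ℝ)..(s' / s₁),
        extendMap (superpose X α) x)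
        (s₁ • ((1 / s₁ : ℝ) • extendMap (superpose X α) (s / s₁))) s := by
      have hi := intervalIntegral.integral_hasDerivAt_right (hcont.intervalIntegrable 0 (s / s₁))
        hcont.stronglyMeasurable.stronglyMeasurableAtFilter hcont.continuousAt
      have hdiv : HasDerivAt (fun s' : ℝ => s' / s₁) (1 / s₁) s := (hasDerivAt_id s).div_const s₁
      exact ((hi.scomp s hdiv).const_smul s₁).const_add y
    obtain ⟨hτ, hτval⟩ := hval s hs₁
    have hend : s₁ • ((1 / s₁ : ℝ) • extendMap (superpose X α) (s / s₁))
        = X ((z (y, s)).2 one) := by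
      rw [smul_smul, mul_one_div_cancel hs₁0.ne', one_smul, extendMap_of_mem _ hτ,
        superpose_apply hX.continuousOn (hzΩ _ hp₁), hτval]
    rw [← hend]
    refine hd.congr_of_eventuallyEq ?_
    filter_upwards [continuousAt_id.abs.eventually_lt continuousAt_const hs₁] with s' hs'
    obtain ⟨hτ', hτval'⟩ := hval s' hs'
    rw [hτval', hformula]

end Flow

/-! ### Iterated derivatives with respect to a linear connection along a line -/

section LinearConnection

variable {E : Type*} [NormedAddCommGroup E] [NormedSpace ℝ E]

/-- The operator `w ↦ w' + B w` on functions of one variable. -/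
def connDeriv (B : ℝ → E →L[ℝ] E) (w : ℝ → E) (t : ℝ) : E := deriv w t + B t (w t)

lemma contDiffOn_connDeriv {A : Set ℝ} (hA : IsOpen A) {B : ℝ → E →L[ℝ] E}
    (hB : ContDiffOn ℝ ∞ B A) {w : ℝ → E} (hw : ContDiffOn ℝ ∞ w A) :
    ContDiffOn ℝ ∞ (connDeriv B w) A :=
  ((contDiffOn_infty_iff_deriv_of_isOpen hA).mp hw).2.add (hB.clm_apply hw)

lemma hasDerivAt_of_contDiffOn {A : Set ℝ} (hA : IsOpen A) {w : ℝ → E}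
    (hw : ContDiffOn ℝ ∞ w A) {t : ℝ} (ht : t ∈ A) : HasDerivAt w (deriv w t) t :=
  ((hw.differentiableOn (by simp)).differentiableAt (hA.mem_nhds ht)).hasDerivAt

/-- The form of the iterated derivatives of `(t - t₀)^m v`. -/
lemma exists_iterate_connDeriv_eq {A : Set ℝ} (hA : IsOpen A) {t₀ : ℝ} {B : ℝ → E →L[ℝ] E}
    (hB : ContDiffOn ℝ ∞ B A) {v : ℝ → E} (hv : ContDiffOn ℝ ∞ v A) {W : ℕ → ℝ → E}
    (hW : ∀ i, ∀ t ∈ A, W (i + 1) t = connDeriv B (W i) t) {m : ℕ}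
    (h0 : ∀ t ∈ A, W 0 t = (t - t₀) ^ m • v t) (j : ℕ) :
    ∀ n, n + j = m → ∃ c d : ℝ, 0 < c ∧ 0 ≤ d ∧ ∃ z : ℝ → E, ContDiffOn ℝ ∞ z A ∧
      ∀ t ∈ A, W j t = (t - t₀) ^ n • (c • v t + ((t - t₀) * d) • connDeriv B v t
        + (t - t₀) ^ 2 • z t) := by
  induction j with
  | zero =>
    rintro n rfl
    exact ⟨1, 0, one_pos, le_rfl, fun _ => 0, contDiffOn_const, fun t ht => by simp [h0 t ht]⟩
  | succ j ih =>
    intro n hn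
    obtain ⟨c, d, hc, hd, z, hz, hWj⟩ := ih (n + 1) (by omega)
    have hDv := contDiffOn_connDeriv hA hB hv
    have hDDv := contDiffOn_connDeriv hA hB hDv
    have hDz := contDiffOn_connDeriv hA hB hz
    -- The Leibniz rule for (t - t₀)^(n+1) (c v + (t - t₀) d Dv + (t - t₀)² z), sorted by powers of
    -- t - t₀. The coefficient n + 3 of z is n + 1 from the outer power plus 2 from the square.
    refine ⟨(n + 1) * c, (n + 1) * d + c + d, by positivity, by positivity,
      fun t => (n + 3 : ℝ) • z t + d • connDeriv B (connDeriv B v) t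
        + (t - t₀) • connDeriv B z t, ?_, ?_⟩
    · exact ((hz.const_smul _).add (hDDv.const_smul _)).add
        ((contDiff_id.sub contDiff_const).contDiffOn.smul hDz)
    · intro t ht
      have hτ : HasDerivAt (fun t => t - t₀) 1 t := (hasDerivAt_id t).sub_const t₀
      have hτn := hτ.pow (n + 1)
      have hτ2 := hτ.pow 2
      have hder := hτn.smul ((((hasDerivAt_of_contDiffOn hA hv ht).const_smul c).add
        ((hτ.mul_const d).smul (hasDerivAt_of_contDiffOn hA hDv ht))).add
        (hτ2.smul (hasDerivAt_of_contDiffOn hA hz ht)))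
      have hWd := hder.congr_of_eventuallyEq
        (Filter.eventually_of_mem (hA.mem_nhds ht) fun s hs => hWj s hs)
      rw [hW j t ht, connDeriv, hWd.deriv, hWj t ht]
      simp only [connDeriv, map_add, map_smul, Pi.add_apply, Pi.smul_apply, Pi.smul_apply',
        Pi.pow_apply, Nat.add_sub_cancel]
      push_cast
      module

/-- After m derivatives no outer power of t - t₀ is left. Evaluation at `t₀` gives c v, and one
further derivative gives (c + d) Dv, the square killing the contribution of z. -/
lemma exists_iterate_connDeriv_eq_at {A : Set ℝ} (hA : IsOpen A) {t₀ : ℝ} (ht₀ : t₀ ∈ A)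
    {B : ℝ → E →L[ℝ] E} (hB : ContDiffOn ℝ ∞ B A) {v : ℝ → E} (hv : ContDiffOn ℝ ∞ v A)
    {W : ℕ → ℝ → E} (hW : ∀ i, ∀ t ∈ A, W (i + 1) t = connDeriv B (W i) t) {m : ℕ}
    (h0 : ∀ t ∈ A, W 0 t = (t - t₀) ^ m • v t) :
    ∃ c c' : ℝ, 0 < c ∧ 0 < c' ∧ W m t₀ = c • v t₀ ∧ W (m + 1) t₀ = c' • connDeriv B v t₀ := by
  obtain ⟨c, d, hc, hd, z, hz, hWm⟩ := exists_iterate_connDeriv_eq hA hB hv hW h0 m 0 (by simp)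
  refine ⟨c, c + d, hc, by positivity, by simpa using hWm t₀ ht₀, ?_⟩
  have hDv := contDiffOn_connDeriv hA hB hv
  have hτ : HasDerivAt (fun t => t - t₀) 1 t₀ := (hasDerivAt_id t₀).sub_const t₀
  have hder := (((hasDerivAt_of_contDiffOn hA hv ht₀).const_smul c).add
    ((hτ.mul_const d).smul (hasDerivAt_of_contDiffOn hA hDv ht₀))).add
    ((hτ.pow 2).smul (hasDerivAt_of_contDiffOn hA hz ht₀))
  have hWd := hder.congr_of_eventuallyEq
    (Filter.eventually_of_mem (hA.mem_nhds ht₀) fun s hs => by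
      simpa using hWm s hs)
  rw [hW m t₀ ht₀, connDeriv, hWd.deriv, hWm t₀ ht₀]
  simp [connDeriv]
  module

/-- If the first `m` iterated derivatives of `w` vanish at `t₀`, then `w` is divisible by
`(t - t₀)^m`. -/
lemma exists_eq_pow_smul_of_iterate_eq_zero [CompleteSpace E] {t₀ r : ℝ} (hr : 0 < r)
    {B : ℝ → E →L[ℝ] E} (hB : ContDiffOn ℝ ∞ B (Set.Ioo (t₀ - r) (t₀ + r))) {W : ℕ → ℝ → E}
    (hW0 : ContDiffOn ℝ ∞ (W 0) (Set.Ioo (t₀ - r) (t₀ + r)))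
    (hW : ∀ i, ∀ t ∈ Set.Ioo (t₀ - r) (t₀ + r), W (i + 1) t = connDeriv B (W i) t) (m : ℕ)
    (hzero : ∀ i < m, W i t₀ = 0) :
    ∃ v : ℝ → E, ContDiffOn ℝ ∞ v (Set.Ioo (t₀ - r) (t₀ + r)) ∧
      ∀ t ∈ Set.Ioo (t₀ - r) (t₀ + r), W 0 t = (t - t₀) ^ m • v t := by
  induction m with
  | zero => exact ⟨W 0, hW0, fun t _ => by simp⟩
  | succ m ih =>
    obtain ⟨v, hv, hWv⟩ := ih fun i hi => hzero i (by omega)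
    obtain ⟨c, -, hc, -, hWm, -⟩ := exists_iterate_connDeriv_eq_at isOpen_Ioo
      (t₀ := t₀) ⟨by linarith, by linarith⟩ hB hv hW hWv
    -- The m-th iterate at `t₀` is a positive multiple of v(t₀), so its vanishing allows one more
    -- division by t - t₀.
    rw [hzero m (by omega), eq_comm, smul_eq_zero_iff_right hc.ne'] at hWm
    obtain ⟨v', hv', hvv'⟩ := exists_eq_sub_smul_of_eq_zero hv hWm
    exact ⟨v', hv', fun t ht => by rw [hWv t ht, hvv' t ht, smul_smul, pow_succ]⟩

/-- If `w = (t - t₀)^m v` is everywhere proportional to the nowhere vanishing `u`, and if the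
values of `v` and of its derivative are linearly independent at `t₀`, then the factor of
proportionality is smooth and the values of `u` and of its derivative are linearly independent. -/
lemma exists_smooth_factor_of_proportional {A : Set ℝ} (hA : IsOpen A) {t₀ : ℝ} (ht₀ : t₀ ∈ A)
    {B : ℝ → E →L[ℝ] E} {u v w : ℝ → E} (hu : ContDiffOn ℝ ∞ u A) (hv : ContDiffOn ℝ ∞ v A)
    {m : ℕ} (hw : ∀ t ∈ A, w t = (t - t₀) ^ m • v t) (hu0 : u t₀ ≠ 0)
    (hprop : ∀ t ∈ A, ∃ a : ℝ, w t = a • u t)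
    (hind : LinearIndependent ℝ ![v t₀, connDeriv B v t₀]) :
    ∃ A' ⊆ A, IsOpen A' ∧ t₀ ∈ A' ∧ ∃ a : ℝ → ℝ, ContDiffOn ℝ ∞ a A' ∧
      (∀ t ∈ A', w t = a t • u t) ∧ LinearIndependent ℝ ![u t₀, connDeriv B u t₀] := by
  -- A functional not vanishing on u(t₀) makes the factor explicit, v = b u with b = ℓ(v)/ℓ(u), and
  -- hence smooth.
  obtain ⟨ℓ, hℓ⟩ := SeparatingDual.exists_ne_zero (R := ℝ) hu0
  have hℓu : ContDiffOn ℝ ∞ (fun t => ℓ (u t)) A := ℓ.contDiff.comp_contDiffOn hu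
  have hℓv : ContDiffOn ℝ ∞ (fun t => ℓ (v t)) A := ℓ.contDiff.comp_contDiffOn hv
  set A' : Set ℝ := A ∩ (fun t => ℓ (u t)) ⁻¹' {0}ᶜ with hA'
  have hA'o : IsOpen A' := hℓu.continuousOn.isOpen_inter_preimage hA isOpen_compl_singleton
  have ht₀' : t₀ ∈ A' := ⟨ht₀, hℓ⟩
  set b : ℝ → ℝ := fun t => ℓ (v t) / ℓ (u t) with hb
  have hbs : ContDiffOn ℝ ∞ b A' :=
    (hℓv.mono Set.inter_subset_left).div (hℓu.mono Set.inter_subset_left) fun t ht => ht.2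
  have hne : ∀ t ∈ A', t ≠ t₀ → v t = b t • u t := by
    intro t ht htt
    obtain ⟨a, ha⟩ := hprop t ht.1
    have hpow : (t - t₀) ^ m ≠ 0 := pow_ne_zero _ (sub_ne_zero.mpr htt)
    have hlu : ℓ (u t) ≠ 0 := ht.2
    rw [hw t ht.1] at ha
    have hℓa : (t - t₀) ^ m * ℓ (v t) = a * ℓ (u t) := by simpa using congrArg ℓ ha
    have hab : a = (t - t₀) ^ m * b t := by
      rw [hb]
      field_simp
      linarith
    rw [hab, mul_smul] at ha
    exact smul_right_injective E hpow ha
  -- Away from `t₀` the power of t - t₀ cancels; at `t₀` the identity follows by continuity.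
  have hvb : ∀ t ∈ A', v t = b t • u t := by
    intro t ht
    by_cases htt : t = t₀
    · subst htt
      have h1 : Filter.Tendsto v (𝓝[≠] t) (𝓝 (v t)) :=
        (hv.continuousOn.continuousAt (hA.mem_nhds ht.1)).tendsto.mono_left nhdsWithin_le_nhds
      have h2 : Filter.Tendsto (fun s => b s • u s) (𝓝[≠] t) (𝓝 (b t • u t)) :=
        ((hbs.continuousOn.continuousAt (hA'o.mem_nhds ht)).smul
          (hu.continuousOn.continuousAt (hA.mem_nhds ht.1))).tendsto.mono_left nhdsWithin_le_nhds
      refine tendsto_nhds_unique h1 (h2.congr' ?_)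
      filter_upwards [self_mem_nhdsWithin, nhdsWithin_le_nhds (hA'o.mem_nhds ht)] with s hs hs'
      exact (hne s hs' hs).symm
    · exact hne t ht htt
  refine ⟨A', Set.inter_subset_left, hA'o, ht₀', fun t => (t - t₀) ^ m * b t, ?_, ?_, ?_⟩
  · exact ContDiffOn.mul (by fun_prop) hbs
  · intro t ht
    rw [hw t ht.1, hvb t ht, mul_smul]
  · have hder := (hasDerivAt_of_contDiffOn hA'o hbs ht₀').smul
      (hasDerivAt_of_contDiffOn hA hu ht₀)
    have hvd := (hder.congr_of_eventuallyEq
      (Filter.eventually_of_mem (hA'o.mem_nhds ht₀') fun s hs => hvb s hs)).deriv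
    have hDv : connDeriv B v t₀ = deriv b t₀ • u t₀ + b t₀ • connDeriv B u t₀ := by
      rw [connDeriv, hvd, hvb t₀ ht₀', connDeriv, map_smul]
      module
    have hb0 : b t₀ ≠ 0 := by
      intro h
      apply hind.ne_zero 0
      simp [hvb t₀ ht₀', h]
    rw [LinearIndependent.pair_iff] at hind ⊢
    intro x y hxy
    -- As Dv = b' u + b Du, these coefficients turn x u + y Du, multiplied by b, into a combination
    -- of v and Dv.
    have := hind (x - y * deriv b t₀ / b t₀) y (by
      rw [hDv, hvb t₀ ht₀', smul_smul]
      have hx : (x - y * deriv b t₀ / b t₀) * b t₀ = x * b t₀ - y * deriv b t₀ := by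
        field_simp
      rw [hx]
      linear_combination (norm := module) (b t₀) • hxy)
    obtain ⟨h1, rfl⟩ := this
    exact ⟨by simpa using h1, rfl⟩

end LinearConnection

/-! ### Tangent surfaces in coordinates -/

section CoordinateSurface

variable {E : Type*} [NormedAddCommGroup E] [NormedSpace ℝ E]

/-- The geodesic spray `(x, v) ↦ (v, -Γ(x)(v, v))` in coordinates. -/
def spray (Γ : E → E →L[ℝ] E →L[ℝ] E) (y : E × E) : E × E := (y.2, -Γ y.1 y.2 y.2)

lemma contDiffOn_spray {Γ : E → E →L[ℝ] E →L[ℝ] E} {Θ : Set E} (hΓ : ContDiffOn ℝ ∞ Γ Θ) :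
    ContDiffOn ℝ ∞ (spray Γ) (Θ ×ˢ Set.univ) := by
  have h : ContDiffOn ℝ ∞ (fun y : E × E => Γ y.1) (Θ ×ˢ Set.univ) :=
    hΓ.comp contDiff_fst.contDiffOn fun y hy => hy.1
  exact contDiff_snd.contDiffOn.prodMk
    ((h.clm_apply contDiff_snd.contDiffOn).clm_apply contDiff_snd.contDiffOn).neg

lemma hasDerivAt_vertical {Q : Set (ℝ × ℝ)} (hQ : IsOpen Q) {H : ℝ × ℝ → E}
    (hH : ContDiffOn ℝ ∞ H Q) {q : ℝ × ℝ} (hq : q ∈ Q) :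
    HasDerivAt (fun s => H (q.1, s)) (fderiv ℝ H q (0, 1)) q.2 :=
  HasFDerivAt.comp_hasDerivAt (f := fun s : ℝ => (q.1, s)) q.2
    ((hH.differentiableOn (by simp)).differentiableAt (hQ.mem_nhds hq)).hasFDerivAt
    ((hasDerivAt_const q.2 q.1).prodMk (hasDerivAt_id q.2))

lemma hasDerivAt_horizontal {Q : Set (ℝ × ℝ)} (hQ : IsOpen Q) {H : ℝ × ℝ → E}
    (hH : ContDiffOn ℝ ∞ H Q) {q : ℝ × ℝ} (hq : q ∈ Q) :
    HasDerivAt (fun t => H (t, q.2)) (fderiv ℝ H q (1, 0)) q.1 :=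
  HasFDerivAt.comp_hasDerivAt (f := fun t : ℝ => (t, q.2)) q.1
    ((hH.differentiableOn (by simp)).differentiableAt (hQ.mem_nhds hq)).hasFDerivAt
    ((hasDerivAt_id q.1).prodMk (hasDerivAt_const q.1 q.2))

lemma fderiv_apply_comm {Q : Set (ℝ × ℝ)} (hQ : IsOpen Q) {H : ℝ × ℝ → E}
    (hH : ContDiffOn ℝ ∞ H Q) {q : ℝ × ℝ} (hq : q ∈ Q) (x y : ℝ × ℝ) :
    fderiv ℝ (fun p => fderiv ℝ H p x) q y = fderiv ℝ (fun p => fderiv ℝ H p y) q x := by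
  have hat : ContDiffAt ℝ ∞ H q := hH.contDiffAt (hQ.mem_nhds hq)
  have hd : DifferentiableAt ℝ (fderiv ℝ H) q :=
    (((contDiffOn_infty_iff_fderiv_of_isOpen hQ).mp hH).2.differentiableOn
      (by simp)).differentiableAt (hQ.mem_nhds hq)
  have hsymm := hat.isSymmSndFDerivAt (by simp only [minSmoothness_of_isRCLikeNormedField]; norm_cast)
  rw [fderiv_clm_apply hd (by fun_prop), fderiv_clm_apply hd (by fun_prop)]
  simpa using hsymm y x

/-- The tangent surface, in coordinates, of a curve `g` with a smooth frame `u` which is linearly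
independent of its covariant derivative at `t₀`. -/
lemma exists_coordinate_tangentSurface [CompleteSpace E] {Γ : E → E →L[ℝ] E →L[ℝ] E} {Θ : Set E}
    (hΘ : IsOpen Θ) (hΓ : ContDiffOn ℝ ∞ Γ Θ) {A : Set ℝ} (hA : IsOpen A) {t₀ : ℝ} (ht₀ : t₀ ∈ A)
    {g u : ℝ → E} (hg : ContDiffOn ℝ ∞ g A) (hgΘ : ∀ t ∈ A, g t ∈ Θ) (hu : ContDiffOn ℝ ∞ u A)
    {a : ℝ → ℝ} (ha : ContDiffOn ℝ ∞ a A) (hga : ∀ t ∈ A, deriv g t = a t • u t)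
    (hind : LinearIndependent ℝ ![u t₀, deriv u t₀ + Γ (g t₀) (u t₀) (deriv g t₀)]) :
    ∃ A' ⊆ A, IsOpen A' ∧ t₀ ∈ A' ∧ ∃ r > 0, ∃ S V W : ℝ × ℝ → E,
      ContDiffOn ℝ ∞ S (A' ×ˢ Set.Ioo (-r) r) ∧ ContDiffOn ℝ ∞ V (A' ×ˢ Set.Ioo (-r) r) ∧
      ContDiffOn ℝ ∞ W (A' ×ˢ Set.Ioo (-r) r) ∧
      (∀ t ∈ A', S (t, 0) = g t ∧ V (t, 0) = u t) ∧
      (∀ q ∈ A' ×ˢ Set.Ioo (-r) r, S q ∈ Θ ∧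
        HasDerivAt (fun s => S (q.1, s)) (V q) q.2 ∧
        HasDerivAt (fun s => V (q.1, s)) (-Γ (S q) (V q) (V q)) q.2 ∧
        fderiv ℝ S q (0, 1) = V q ∧
        fderiv ℝ S q (1, 0) = a q.1 • V q + q.2 • W q) ∧
      LinearIndependent ℝ ![W (t₀, 0), V (t₀, 0)] := by
  obtain ⟨r, hr, Φ, hΦ, hΦ0, hΦd⟩ := exists_smooth_flow (hΘ.prod isOpen_univ)
    (contDiffOn_spray hΓ) (y₀ := (g t₀, u t₀)) ⟨hgΘ t₀ ht₀, Set.mem_univ _⟩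
  have hgu : ContDiffOn ℝ ∞ (fun t => (g t, u t)) A := hg.prodMk hu
  set A' : Set ℝ := A ∩ (fun t => (g t, u t)) ⁻¹' Metric.ball (g t₀, u t₀) r with hA'
  have hA'A : A' ⊆ A := Set.inter_subset_left
  have hA'o : IsOpen A' := hgu.continuousOn.isOpen_inter_preimage hA Metric.isOpen_ball
  have ht₀' : t₀ ∈ A' := ⟨ht₀, Metric.mem_ball_self hr⟩
  set Q : Set (ℝ × ℝ) := A' ×ˢ Set.Ioo (-r) r with hQ
  have hQo : IsOpen Q := hA'o.prod isOpen_Ioo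
  have h0r : (0 : ℝ) ∈ Set.Ioo (-r) r := ⟨by linarith, hr⟩
  have hψ : ContDiffOn ℝ ∞ (fun q : ℝ × ℝ => Φ ((g q.1, u q.1), q.2)) Q := by
    refine hΦ.comp (f := fun q : ℝ × ℝ => ((g q.1, u q.1), q.2)) ?_ fun q hq => ⟨hq.1.2, hq.2⟩
    exact (hgu.comp contDiff_fst.contDiffOn fun q hq => hq.1.1).prodMk contDiff_snd.contDiffOn
  set S : ℝ × ℝ → E := fun q => (Φ ((g q.1, u q.1), q.2)).1 with hSdef
  set V : ℝ × ℝ → E := fun q => (Φ ((g q.1, u q.1), q.2)).2 with hVdef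
  have hS : ContDiffOn ℝ ∞ S Q := contDiff_fst.comp_contDiffOn hψ
  have hV : ContDiffOn ℝ ∞ V Q := contDiff_snd.comp_contDiffOn hψ
  have hS0 : ∀ t ∈ A', S (t, 0) = g t := fun t ht => by rw [hSdef]; simp [hΦ0 _ ht.2]
  have hV0 : ∀ t ∈ A', V (t, 0) = u t := fun t ht => by rw [hVdef]; simp [hΦ0 _ ht.2]
  have hSd : ∀ q ∈ Q, HasDerivAt (fun s => S (q.1, s)) (V q) q.2 := fun q hq =>
    (hΦd _ hq.1.2 _ hq.2).2.fst
  have hVd : ∀ q ∈ Q, HasDerivAt (fun s => V (q.1, s)) (-Γ (S q) (V q) (V q)) q.2 := fun q hq =>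
    (hΦd _ hq.1.2 _ hq.2).2.snd
  have hSs : ∀ q ∈ Q, fderiv ℝ S q (0, 1) = V q := fun q hq =>
    (hasDerivAt_vertical hQo hS hq).unique (hSd q hq)
  have hS' := ((contDiffOn_infty_iff_fderiv_of_isOpen hQo).mp hS).2
  have hSt : ContDiffOn ℝ ∞ (fun q => fderiv ℝ S q (1, 0)) Q := hS'.clm_apply contDiffOn_const
  have haQ : ContDiffOn ℝ ∞ (fun q : ℝ × ℝ => a q.1) Q :=
    ha.comp contDiff_fst.contDiffOn fun q hq => hA'A hq.1
  have hderiv_eq : ∀ t ∈ A', fderiv ℝ S (t, 0) (1, 0) = a t • u t := by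
    intro t ht
    rw [← hga t (hA'A ht)]
    refine (hasDerivAt_horizontal hQo hS (q := (t, 0)) ⟨ht, h0r⟩).unique ?_
    exact (hasDerivAt_of_contDiffOn hA hg (hA'A ht)).congr_of_eventuallyEq
      (Filter.eventually_of_mem (hA'o.mem_nhds ht) hS0)
  -- Along s = 0 the surface is the curve, so ∂S/∂t = γ' = a u = a V there and the difference is
  -- divisible by s.
  obtain ⟨W, hW, hWeq⟩ := exists_eq_smul_of_eq_zero hA'o (hSt.sub (haQ.smul hV)) (fun t ht => by
    change fderiv ℝ S (t, 0) (1, 0) - a t • V (t, 0) = 0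
    rw [hderiv_eq t ht, hV0 t ht, sub_self])
  have hWeq' : ∀ q ∈ Q, fderiv ℝ S q (1, 0) = a q.1 • V q + q.2 • W q := fun q hq => by
    rw [← hWeq q hq]
    exact (add_sub_cancel _ _).symm
  refine ⟨A', hA'A, hA'o, ht₀', r, hr, S, V, W, hS, hV, hW, fun t ht => ⟨hS0 t ht, hV0 t ht⟩,
    fun q hq => ⟨(hΦd _ hq.1.2 _ hq.2).1.1, hSd q hq, hVd q hq, hSs q hq, hWeq' q hq⟩, ?_⟩
  have hq₀ : (t₀, (0 : ℝ)) ∈ Q := ⟨ht₀', h0r⟩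
  have hmixed : fderiv ℝ (fun q => fderiv ℝ S q (1, 0)) (t₀, 0) (0, 1) = deriv u t₀ := by
    rw [fderiv_apply_comm hQo hS hq₀]
    have hcongr : (fun q => fderiv ℝ S q (0, 1)) =ᶠ[𝓝 (t₀, 0)] V :=
      Filter.eventually_of_mem (hQo.mem_nhds hq₀) hSs
    rw [hcongr.fderiv_eq]
    refine (hasDerivAt_horizontal hQo hV hq₀).unique ?_
    exact (hasDerivAt_of_contDiffOn hA hu ht₀).congr_of_eventuallyEq
      (Filter.eventually_of_mem (hA'o.mem_nhds ht₀') hV0)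
  -- Differentiate ∂S/∂t = a V + s W in s at s = 0. The left side is u' by symmetry of second
  -- derivatives; the right side is -a Γ(u, u) + W by the geodesic equation, and a u = g'.
  have hW0 : W (t₀, 0) = deriv u t₀ + Γ (g t₀) (u t₀) (deriv g t₀) := by
    have h1 := hasDerivAt_vertical hQo hSt hq₀
    have h2 := ((hasDerivAt_const (0 : ℝ) (a t₀)).smul (hVd _ hq₀)).add
      ((hasDerivAt_id (0 : ℝ)).smul (hasDerivAt_vertical hQo hW hq₀))
    have h3 := h1.unique (h2.congr_of_eventuallyEq
      (Filter.eventually_of_mem (isOpen_Ioo.mem_nhds h0r) fun s hs =>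
        hWeq' (t₀, s) ⟨ht₀', hs⟩))
    rw [hmixed] at h3
    rw [hS0 t₀ ht₀', hV0 t₀ ht₀'] at h3
    rw [h3, hga t₀ ht₀, map_smul]
    simp
  rw [hW0, hV0 t₀ ht₀']
  exact LinearIndependent.pair_symm_iff.mp hind

end CoordinateSurface

/-! ### Components of tangent vectors and of vector fields -/

section Components

variable {E : Type*} [NormedAddCommGroup E] [NormedSpace ℝ E]
  {M : Type*} [TopologicalSpace M] [ChartedSpace E M] [IsManifold 𝓘(ℝ, E) ∞ M]

lemma coordComponents_eq {x₀ x : M} (hx : x ∈ (chartAt E x₀).source)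
    (v : TangentSpace 𝓘(ℝ, E) x) :
    coordComponents x₀ v =
      (trivializationAt E (TangentSpace 𝓘(ℝ, E) : M → Type _) x₀).continuousLinearMapAt ℝ x v :=
  (Bundle.Trivialization.continuousLinearMapAt_apply_of_mem ℝ _ hx v).symm

lemma coordField_eq {x₀ x : M} (hx : x ∈ (chartAt E x₀).source) (e : E) :
    coordField x₀ e x =
      (trivializationAt E (TangentSpace 𝓘(ℝ, E) : M → Type _) x₀).symmL ℝ x e :=
  (Bundle.Trivialization.symmL_apply _ hx e).symm

lemma coordComponents_coordField {x₀ x : M} (hx : x ∈ (chartAt E x₀).source) (e : E) :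
    coordComponents x₀ (coordField x₀ e x) = e := by
  rw [coordComponents_eq hx, coordField_eq hx]
  exact Bundle.Trivialization.continuousLinearMapAt_symmL _ hx e

lemma coordField_coordComponents {x₀ x : M} (hx : x ∈ (chartAt E x₀).source)
    (v : TangentSpace 𝓘(ℝ, E) x) : coordField x₀ (coordComponents x₀ v) x = v := by
  rw [coordComponents_eq hx, coordField_eq hx]
  exact Bundle.Trivialization.symmL_continuousLinearMapAt _ hx v

lemma coordComponents_add {x₀ x : M} (hx : x ∈ (chartAt E x₀).source)
    (v w : TangentSpace 𝓘(ℝ, E) x) :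
    coordComponents x₀ (v + w) = coordComponents x₀ v + coordComponents x₀ w := by
  simp only [coordComponents_eq hx, map_add]

lemma coordComponents_smul {x₀ x : M} (hx : x ∈ (chartAt E x₀).source) (c : ℝ)
    (v : TangentSpace 𝓘(ℝ, E) x) :
    coordComponents x₀ (c • v) = c • coordComponents x₀ v := by
  simp only [coordComponents_eq hx, map_smul]

lemma coordComponents_zero {x₀ x : M} (hx : x ∈ (chartAt E x₀).source) :
    coordComponents x₀ (0 : TangentSpace 𝓘(ℝ, E) x) = 0 := by
  simp only [coordComponents_eq hx, map_zero]

lemma coordComponents_injective {x₀ x : M} (hx : x ∈ (chartAt E x₀).source)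
    {v w : TangentSpace 𝓘(ℝ, E) x} (h : coordComponents x₀ v = coordComponents x₀ w) : v = w := by
  rw [← coordField_coordComponents hx v, h, coordField_coordComponents hx]

lemma coordField_add {x₀ x : M} (hx : x ∈ (chartAt E x₀).source) (e e' : E) :
    coordField x₀ (e + e') x = coordField x₀ e x + coordField x₀ e' x := by
  simp only [coordField_eq hx, map_add]

lemma coordField_smul {x₀ x : M} (hx : x ∈ (chartAt E x₀).source) (c : ℝ) (e : E) :
    coordField x₀ (c • e) x = c • coordField x₀ e x := by
  simp only [coordField_eq hx, map_smul]

/-- The components of the derivative of a map into `M` are the derivative of its expression in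
coordinates. -/
lemma coordComponents_mfderiv {P : Type*} [NormedAddCommGroup P] [NormedSpace ℝ P] {f : P → M}
    {q : P} (hf : MDifferentiableAt 𝓘(ℝ, P) 𝓘(ℝ, E) f q) {x₀ : M}
    (hx : f q ∈ (chartAt E x₀).source) (ξ : P) :
    coordComponents x₀ (mfderiv 𝓘(ℝ, P) 𝓘(ℝ, E) f q ξ)
      = fderiv ℝ (fun p => extChartAt 𝓘(ℝ, E) x₀ (f p)) q ξ := by
  rw [coordComponents_eq hx, TangentBundle.continuousLinearMapAt_trivializationAt hx]
  have hφ : MDifferentiableAt 𝓘(ℝ, E) 𝓘(ℝ, E) (extChartAt 𝓘(ℝ, E) x₀) (f q) :=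
    mdifferentiableAt_extChartAt hx
  have := mfderiv_comp q hφ hf
  rw [← mfderiv_eq_fderiv]
  exact (congrArg (fun L => L ξ) this).symm

lemma coordComponents_velocity {γ : ℝ → M} {t : ℝ}
    (hγ : MDifferentiableAt 𝓘(ℝ, ℝ) 𝓘(ℝ, E) γ t) {x₀ : M} (hx : γ t ∈ (chartAt E x₀).source) :
    coordComponents x₀ (velocity γ t) = deriv (fun τ => extChartAt 𝓘(ℝ, E) x₀ (γ τ)) t :=
  coordComponents_mfderiv hγ hx 1

lemma contMDiffOn_coordField (x₀ : M) (e : E) :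
    ContMDiffOn 𝓘(ℝ, E) 𝓘(ℝ, E).tangent ∞
      (fun x => (⟨x, coordField x₀ e x⟩ : TangentBundle 𝓘(ℝ, E) M)) (chartAt E x₀).source := by
  refine ((trivializationAt E (TangentSpace 𝓘(ℝ, E) : M → Type _)
    x₀).contMDiffOn_section_baseSet_iff).mpr ?_
  exact (contMDiffOn_const (c := e)).congr fun x hx => coordComponents_coordField hx e

lemma mdifferentiableAt_coordField {x₀ x : M} (hx : x ∈ (chartAt E x₀).source) (e : E) :
    MDifferentiableAt 𝓘(ℝ, E) 𝓘(ℝ, E).tangent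
      (fun x => (⟨x, coordField x₀ e x⟩ : TangentBundle 𝓘(ℝ, E) M)) x :=
  ((contMDiffOn_coordField x₀ e).contMDiffAt
    ((chartAt E x₀).open_source.mem_nhds hx)).mdifferentiableAt (by simp)

lemma mdifferentiableAt_coordComponents {x₁ x : M} (hx : x ∈ (chartAt E x₁).source)
    {X : ∀ x : M, TangentSpace 𝓘(ℝ, E) x}
    (hX : MDifferentiableAt 𝓘(ℝ, E) 𝓘(ℝ, E).tangent
      (fun x => (⟨x, X x⟩ : TangentBundle 𝓘(ℝ, E) M)) x) :
    MDifferentiableAt 𝓘(ℝ, E) 𝓘(ℝ, E) (fun y => coordComponents x₁ (X y)) x :=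
  ((trivializationAt E (TangentSpace 𝓘(ℝ, E) : M → Type _)
    x₁).mdifferentiableAt_section_iff 𝓘(ℝ, E) _ hx).mp hX

/-- A smooth map into the tangent bundle, over a map into the domain of a chart, is one with smooth
base map and smooth components. -/
lemma contMDiffOn_tangentBundle_iff {P : Type*} [NormedAddCommGroup P] [NormedSpace ℝ P]
    {f : P → M} {X : ∀ q, TangentSpace 𝓘(ℝ, E) (f q)} {U : Set P} {x₀ : M}
    (hU : ∀ q ∈ U, f q ∈ (chartAt E x₀).source) :
    ContMDiffOn 𝓘(ℝ, P) 𝓘(ℝ, E).tangent ∞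
      (fun q => (⟨f q, X q⟩ : TangentBundle 𝓘(ℝ, E) M)) U ↔
    ContMDiffOn 𝓘(ℝ, P) 𝓘(ℝ, E) ∞ f U ∧ ContDiffOn ℝ ∞ (fun q => coordComponents x₀ (X q)) U := by
  rw [← contMDiffOn_iff_contDiffOn]
  exact (trivializationAt E (TangentSpace 𝓘(ℝ, E) : M → Type _) x₀).contMDiffOn_iff hU

lemma contDiffOn_extChartAt_comp {P : Type*} [NormedAddCommGroup P] [NormedSpace ℝ P]
    {f : P → M} {U : Set P} {x₀ : M} (hf : ContMDiffOn 𝓘(ℝ, P) 𝓘(ℝ, E) ∞ f U)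
    (hU : ∀ q ∈ U, f q ∈ (chartAt E x₀).source) :
    ContDiffOn ℝ ∞ (fun q => extChartAt 𝓘(ℝ, E) x₀ (f q)) U := by
  rw [← contMDiffOn_iff_contDiffOn]
  exact (contMDiffOn_extChartAt (x := x₀)).comp hf hU

end Components

/-! ### Covariant derivatives in coordinates -/

section CovariantDerivative

variable {E : Type*} [NormedAddCommGroup E] [NormedSpace ℝ E] [FiniteDimensional ℝ E]
  {M : Type*} [TopologicalSpace M] [ChartedSpace E M] [IsManifold 𝓘(ℝ, E) ∞ M]

/-- The covariant derivative of a vector field in terms of its components. -/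
lemma cov_eq_components (cov : AffineConnection E M) {x₁ x : M} (hx : x ∈ (chartAt E x₁).source)
    {X : ∀ x : M, TangentSpace 𝓘(ℝ, E) x}
    (hX : MDifferentiableAt 𝓘(ℝ, E) 𝓘(ℝ, E).tangent
      (fun x => (⟨x, X x⟩ : TangentBundle 𝓘(ℝ, E) M)) x) (v : TangentSpace 𝓘(ℝ, E) x) :
    cov X x v = coordField x₁ (mvfderiv 𝓘(ℝ, E) (fun y => coordComponents x₁ (X y)) x v) x
      + cov (coordField x₁ (coordComponents x₁ (X x))) x v := by
  have hcov := cov.isCovariantDerivativeOnUniv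
  have hnear : ∀ᶠ y in 𝓝 x, y ∈ (chartAt E x₁).source :=
    (chartAt E x₁).open_source.mem_nhds hx
  have hcongr : ∀ {f g : M → E}, f =ᶠ[𝓝 x] g →
      mvfderiv 𝓘(ℝ, E) f x v = mvfderiv 𝓘(ℝ, E) g x v := fun {f g} h => by
    simp only [mvfderiv]
    exact congrArg (fun L : TangentSpace 𝓘(ℝ, E) x →L[ℝ] E => L v) h.mfderiv_eq
  -- The connection and the componentwise derivative obey the same Leibniz rule, so their difference
  -- depends only on the value X(x). It may be computed on the field with the same value and
  -- constant components, whose componentwise derivative is zero.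
  have hT : TensorialAt 𝓘(ℝ, E) E (fun Y : ∀ x : M, TangentSpace 𝓘(ℝ, E) x =>
      cov Y x v - coordField x₁ (mvfderiv 𝓘(ℝ, E) (fun y => coordComponents x₁ (Y y)) x v) x)
      x := by
    constructor
    · intro f Y hf hY
      have h1 : cov (f • Y) x v = f x • cov Y x v + mvfderiv 𝓘(ℝ, E) f x v • Y x := by
        have := congrArg (fun L => L v) (hcov.leibniz hY hf (Set.mem_univ x))
        simpa using this
      have h2 : mvfderiv 𝓘(ℝ, E) (fun y => coordComponents x₁ ((f • Y) y)) x v =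
          f x • mvfderiv 𝓘(ℝ, E) (fun y => coordComponents x₁ (Y y)) x v
            + mvfderiv 𝓘(ℝ, E) f x v • coordComponents x₁ (Y x) := by
        rw [hcongr (f := fun y => coordComponents x₁ ((f • Y) y)) (g := f • fun y => coordComponents x₁ (Y y))
          (hnear.mono fun y hy => coordComponents_smul hy _ _),
          mvfderiv_smul hf (mdifferentiableAt_coordComponents hx hY)]
        rfl
      simp only [h1, h2, coordField_add hx, coordField_smul hx, coordField_coordComponents hx]
      module
    · intro Y Z hY hZ
      have h1 : cov (Y + Z) x v = cov Y x v + cov Z x v := by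
        have := congrArg (fun L => L v) (hcov.add hY hZ (Set.mem_univ x))
        simpa using this
      have h2 : mvfderiv 𝓘(ℝ, E) (fun y => coordComponents x₁ ((Y + Z) y)) x v =
          mvfderiv 𝓘(ℝ, E) (fun y => coordComponents x₁ (Y y)) x v
            + mvfderiv 𝓘(ℝ, E) (fun y => coordComponents x₁ (Z y)) x v := by
        rw [hcongr (f := fun y => coordComponents x₁ ((Y + Z) y))
          (g := (fun y => coordComponents x₁ (Y y)) + fun y => coordComponents x₁ (Z y))
          (hnear.mono fun y hy => coordComponents_add hy _ _),
          mvfderiv_add (mdifferentiableAt_coordComponents hx hY)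
            (mdifferentiableAt_coordComponents hx hZ)]
        rfl
      simp only [h1, h2, coordField_add hx]
      abel
  have hpt := hT.pointwise hX (mdifferentiableAt_coordField hx (coordComponents x₁ (X x)))
    (coordField_coordComponents hx (X x)).symm
  have hz : mvfderiv 𝓘(ℝ, E)
      (fun y => coordComponents x₁ (coordField x₁ (coordComponents x₁ (X x)) y)) x v = 0 := by
    rw [hcongr (g := fun _ => coordComponents x₁ (X x))
      (hnear.mono fun y hy => coordComponents_coordField hy _), mvfderiv_const]
    rfl
  simp only [hz] at hpt
  rw [sub_eq_iff_eq_add] at hpt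
  rw [hpt, coordField_eq hx 0, map_zero, sub_zero, add_comm]

end CovariantDerivative

/-! ### Christoffel symbols -/

section Christoffel

variable {E : Type*} [NormedAddCommGroup E] [NormedSpace ℝ E] [FiniteDimensional ℝ E]
  {M : Type*} [TopologicalSpace M] [ChartedSpace E M] [IsManifold 𝓘(ℝ, E) ∞ M]

lemma cov_coordField_add (cov : AffineConnection E M) {x₀ x : M}
    (hx : x ∈ (chartAt E x₀).source) (e e' : E) :
    cov (coordField x₀ (e + e')) x = cov (coordField x₀ e) x + cov (coordField x₀ e') x := by
  have hcov := cov.isCovariantDerivativeOnUniv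
  have h1 := mdifferentiableAt_coordField hx e
  have h2 := mdifferentiableAt_coordField hx e'
  rw [← hcov.add h1 h2 (Set.mem_univ x)]
  refine hcov.congr_of_eventuallyEq (mdifferentiableAt_coordField hx _)
    (mdifferentiableAt_add_section h1 h2) Filter.univ_mem ?_
  filter_upwards [(chartAt E x₀).open_source.mem_nhds hx] with y hy
  exact coordField_add hy e e'

lemma cov_coordField_smul (cov : AffineConnection E M) {x₀ x : M}
    (hx : x ∈ (chartAt E x₀).source) (c : ℝ) (e : E) :
    cov (coordField x₀ (c • e)) x = c • cov (coordField x₀ e) x := by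
  have hcov := cov.isCovariantDerivativeOnUniv
  have h1 := mdifferentiableAt_coordField hx e
  rw [← hcov.smul_const c h1 (Set.mem_univ x)]
  refine hcov.congr_of_eventuallyEq (mdifferentiableAt_coordField hx _)
    (MDifferentiableAt.smul_section mdifferentiableAt_const h1) Filter.univ_mem ?_
  filter_upwards [(chartAt E x₀).open_source.mem_nhds hx] with y hy
  exact coordField_smul hy c e

lemma extChartAt_symm_mem {x₀ : M} {y : E} (hy : y ∈ (extChartAt 𝓘(ℝ, E) x₀).target) :
    (extChartAt 𝓘(ℝ, E) x₀).symm y ∈ (chartAt E x₀).source := by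
  simpa using (extChartAt 𝓘(ℝ, E) x₀).map_target hy

open Classical in
/-- The Christoffel symbols of `∇` in the chart at `x₀`: the components of
`∇_{∑ vⁱ ∂ᵢ} (∑ eⁱ ∂ᵢ)`, at the point with the coordinates `y`, as a bilinear map of `e` and `v`. -/
def christoffel (cov : AffineConnection E M) (x₀ : M) (y : E) : E →L[ℝ] E →L[ℝ] E :=
  if hy : y ∈ (extChartAt 𝓘(ℝ, E) x₀).target then
    LinearMap.toContinuousLinearMap
      { toFun := fun e =>
          ((trivializationAt E (TangentSpace 𝓘(ℝ, E) : M → Type _) x₀).continuousLinearMapAt ℝ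
            ((extChartAt 𝓘(ℝ, E) x₀).symm y)).comp
            ((cov (coordField x₀ e) ((extChartAt 𝓘(ℝ, E) x₀).symm y)).comp
              ((trivializationAt E (TangentSpace 𝓘(ℝ, E) : M → Type _) x₀).symmL ℝ
                ((extChartAt 𝓘(ℝ, E) x₀).symm y)))
        map_add' := fun e e' => by
          rw [cov_coordField_add cov (extChartAt_symm_mem hy), ContinuousLinearMap.add_comp,
            ContinuousLinearMap.comp_add]
        map_smul' := fun c e => by
          rw [cov_coordField_smul cov (extChartAt_symm_mem hy), ContinuousLinearMap.smul_comp,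
            ContinuousLinearMap.comp_smul]
          rfl }
  else 0

lemma christoffel_apply_of_mem_target (cov : AffineConnection E M) {x₀ : M} {y : E}
    (hy : y ∈ (extChartAt 𝓘(ℝ, E) x₀).target) (e v : E) :
    christoffel cov x₀ y e v = coordComponents x₀
      (cov (coordField x₀ e) ((extChartAt 𝓘(ℝ, E) x₀).symm y)
        (coordField x₀ v ((extChartAt 𝓘(ℝ, E) x₀).symm y))) := by
  rw [christoffel, dif_pos hy, coordComponents_eq (extChartAt_symm_mem hy),
    coordField_eq (extChartAt_symm_mem hy) v]
  rfl

lemma christoffel_apply (cov : AffineConnection E M) {x₀ x : M}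
    (hx : x ∈ (chartAt E x₀).source) (e : E) (v : TangentSpace 𝓘(ℝ, E) x) :
    christoffel cov x₀ (extChartAt 𝓘(ℝ, E) x₀ x) e (coordComponents x₀ v)
      = coordComponents x₀ (cov (coordField x₀ e) x v) := by
  have hx' : x ∈ (extChartAt 𝓘(ℝ, E) x₀).source := by simpa using hx
  rw [christoffel_apply_of_mem_target cov ((extChartAt 𝓘(ℝ, E) x₀).map_source hx'),
    (extChartAt 𝓘(ℝ, E) x₀).left_inv hx', coordField_coordComponents hx]

/-- Smoothness of the connection is a statement about smooth sections over all of M, whereas a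
coordinate field is known to be smooth only on the chart domain. Multiplication by a bump function
makes it global, and locality of the connection makes this harmless where the bump function is 1. -/
lemma contMDiffOn_cov_coordField [T2Space M] (cov : AffineConnection E M)
    [CovariantDerivative.ContMDiffCovariantDerivative cov ∞] (x₀ : M) (e v : E) :
    ContMDiffOn 𝓘(ℝ, E) 𝓘(ℝ, E) ∞
      (fun x => coordComponents x₀ (cov (coordField x₀ e) x (coordField x₀ v x)))
      (chartAt E x₀).source := by
  have hcov := cov.isCovariantDerivativeOnUniv
  have hopen := (chartAt E x₀).open_source
  refine (Bundle.Trivialization.contMDiffOn_section_baseSet_iff (IB := 𝓘(ℝ, E)) (n := ∞)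
    (s := fun x => cov (coordField x₀ e) x (coordField x₀ v x))
    (trivializationAt E (TangentSpace 𝓘(ℝ, E) : M → Type _) x₀)).mp ?_
  intro x₁ hx₁
  refine ContMDiffAt.contMDiffWithinAt ?_
  obtain ⟨χ, -, hχ⟩ := (SmoothBumpFunction.nhds_basis_tsupport (I := 𝓘(ℝ, E)) x₁).mem_iff.mp
    (hopen.mem_nhds hx₁)
  have hσ : ContMDiff 𝓘(ℝ, E) 𝓘(ℝ, E).tangent ∞
      (fun x => (⟨x, ((χ : M → ℝ) • coordField x₀ e) x⟩ : TangentBundle 𝓘(ℝ, E) M)) :=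
    ContMDiffOn.smul_section_of_tsupport χ.contMDiff.contMDiffOn hopen hχ
      (contMDiffOn_coordField x₀ e)
  have hs := (CovariantDerivative.ContMDiffCovariantDerivative.contMDiff
    (cov := cov) (k := ∞)).contMDiff (σ := (χ : M → ℝ) • coordField x₀ e) hσ.contMDiffOn
  have hs₁ := hs.contMDiffAt (x := x₁) Filter.univ_mem
  have happ := hs₁.clm_bundle_apply ((contMDiffOn_coordField x₀ v).contMDiffAt
    (hopen.mem_nhds hx₁))
  refine happ.congr_of_eventuallyEq ?_
  filter_upwards [hopen.mem_nhds hx₁, χ.eventuallyEq_one.eventually_nhds] with x hx hχx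
  congr 2
  refine hcov.congr_of_eventuallyEq (mdifferentiableAt_coordField hx e)
    (hσ.mdifferentiable (by simp) x) Filter.univ_mem ?_
  filter_upwards [hχx] with y hy
  simp [hy]

lemma contDiffOn_christoffel [T2Space M] (cov : AffineConnection E M)
    [CovariantDerivative.ContMDiffCovariantDerivative cov ∞] (x₀ : M) :
    ContDiffOn ℝ ∞ (christoffel cov x₀) (extChartAt 𝓘(ℝ, E) x₀).target := by
  rw [contDiffOn_clm_apply]
  intro e
  rw [contDiffOn_clm_apply]
  intro v
  have h := (contMDiffOn_cov_coordField cov x₀ e v).comp (contMDiffOn_extChartAt_symm x₀)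
    fun y hy => extChartAt_symm_mem hy
  exact (contMDiffOn_iff_contDiffOn.mp h).congr fun y hy =>
    christoffel_apply_of_mem_target cov hy e v

end Christoffel

/-! ### Covariant derivatives along curves -/

section AlongCurves

variable {E : Type*} [NormedAddCommGroup E] [NormedSpace ℝ E] [FiniteDimensional ℝ E]
  {M : Type*} [TopologicalSpace M] [ChartedSpace E M] [IsManifold 𝓘(ℝ, E) ∞ M]

/-- The covariant derivative along a curve does not depend on the coordinates used. -/
lemma covDerivAlongInChart_eq (cov : AffineConnection E M) {x₀ x₁ : M} {γ : ℝ → M}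
    {w : ∀ t : ℝ, TangentSpace 𝓘(ℝ, E) (γ t)} {t : ℝ}
    (hγ : MDifferentiableAt 𝓘(ℝ, ℝ) 𝓘(ℝ, E) γ t)
    (hw : DifferentiableAt ℝ (fun τ => coordComponents x₀ (w τ)) t)
    (hx₀ : γ t ∈ (chartAt E x₀).source) (hx₁ : γ t ∈ (chartAt E x₁).source) :
    covDerivAlongInChart cov x₁ γ w t = covDerivAlongInChart cov x₀ γ w t := by
  set T₀ := trivializationAt E (TangentSpace 𝓘(ℝ, E) : M → Type _) x₀
  set T₁ := trivializationAt E (TangentSpace 𝓘(ℝ, E) : M → Type _) x₁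
  -- With the transition matrix A the components of w in the second chart are A(γ) w₀. The extra
  -- term (A ∘ γ)' w₀ in their derivative is the derivative, in the second chart, of the components
  -- of a constant-component field of the first, and so is accounted for by `cov_eq_components`.
  set A : M → E →L[ℝ] E := fun x => (T₀.coordChangeL ℝ T₁ x : E →L[ℝ] E) with hA
  have hAapp : ∀ x ∈ (chartAt E x₀).source ∩ (chartAt E x₁).source, ∀ e : E,
      A x e = coordComponents x₁ (coordField x₀ e x) := fun x hx e =>
    T₀.coordChangeL_apply T₁ hx e
  have hopen : IsOpen ((chartAt E x₀).source ∩ (chartAt E x₁).source) :=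
    (chartAt E x₀).open_source.inter (chartAt E x₁).open_source
  have hnear : ∀ᶠ x in 𝓝 (γ t), x ∈ (chartAt E x₀).source ∩ (chartAt E x₁).source :=
    hopen.mem_nhds ⟨hx₀, hx₁⟩
  have hnear' : ∀ᶠ τ in 𝓝 t, γ τ ∈ (chartAt E x₀).source ∩ (chartAt E x₁).source :=
    hγ.continuousAt.eventually hnear
  have hAd : MDifferentiableAt 𝓘(ℝ, E) 𝓘(ℝ, E →L[ℝ] E) A (γ t) :=
    (contMDiffAt_coordChangeL (IB := 𝓘(ℝ, E)) (n := ∞) (e := T₀) (e' := T₁)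
      hx₀ hx₁).mdifferentiableAt (by simp)
  have hAγ : DifferentiableAt ℝ (fun τ => A (γ τ)) t :=
    (hAd.comp t hγ).differentiableAt
  set e := coordComponents x₀ (w t) with he
  have hcomp : (fun τ => coordComponents x₁ (w τ)) =ᶠ[𝓝 t]
      fun τ => A (γ τ) (coordComponents x₀ (w τ)) := by
    filter_upwards [hnear'] with τ hτ
    rw [hAapp _ hτ, coordField_coordComponents hτ.1]
  have hderiv : deriv (fun τ => coordComponents x₁ (w τ)) t =
      deriv (fun τ => A (γ τ)) t e + A (γ t) (deriv (fun τ => coordComponents x₀ (w τ)) t) := by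
    rw [hcomp.deriv_eq]
    exact (hAγ.hasDerivAt.clm_apply hw.hasDerivAt).deriv
  have hAe : deriv (fun τ => A (γ τ)) t e =
      mvfderiv 𝓘(ℝ, E) (fun y => coordComponents x₁ (coordField x₀ e y)) (γ t)
        (velocity γ t) := by
    have h1 : deriv (fun τ => A (γ τ)) t e = deriv (fun τ => A (γ τ) e) t := by
      have := (hAγ.hasDerivAt.clm_apply (hasDerivAt_const t e)).deriv
      simpa using this.symm
    have hAe' : MDifferentiableAt 𝓘(ℝ, E) 𝓘(ℝ, E)
        (fun y => coordComponents x₁ (coordField x₀ e y)) (γ t) :=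
      mdifferentiableAt_coordComponents hx₁ (mdifferentiableAt_coordField hx₀ e)
    have h2 : (fun τ => A (γ τ) e) =ᶠ[𝓝 t]
        fun τ => coordComponents x₁ (coordField x₀ e (γ τ)) :=
      hnear'.mono fun τ hτ => hAapp _ hτ e
    rw [h1, h2.deriv_eq, ← fderiv_apply_one_eq_deriv]
    have h3 := mfderiv_comp t hAe' hγ
    rw [mfderiv_eq_fderiv] at h3
    exact congrArg (fun L : ℝ →L[ℝ] E => L 1) h3
  have hcov := cov_eq_components cov hx₁ (mdifferentiableAt_coordField hx₀ e) (velocity γ t)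
  rw [coordField_coordComponents hx₀] at hcov
  rw [covDerivAlongInChart, covDerivAlongInChart, hcov, hderiv, hAe, coordField_add hx₁,
    hAapp _ ⟨hx₀, hx₁⟩, coordField_coordComponents hx₁]
  abel

/-- The definition uses a chart that moves with t. Coordinate independence moves it to one fixed
chart, where the formula can be iterated and differentiated. -/
lemma coordComponents_covDerivAlong (cov : AffineConnection E M) {x₀ : M} {γ : ℝ → M}
    {w : ∀ t : ℝ, TangentSpace 𝓘(ℝ, E) (γ t)} {t : ℝ}
    (hγ : MDifferentiableAt 𝓘(ℝ, ℝ) 𝓘(ℝ, E) γ t)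
    (hw : DifferentiableAt ℝ (fun τ => coordComponents x₀ (w τ)) t)
    (hx₀ : γ t ∈ (chartAt E x₀).source) :
    coordComponents x₀ (covDerivAlong cov γ w t) =
      deriv (fun τ => coordComponents x₀ (w τ)) t
        + christoffel cov x₀ (extChartAt 𝓘(ℝ, E) x₀ (γ t)) (coordComponents x₀ (w t))
          (deriv (fun τ => extChartAt 𝓘(ℝ, E) x₀ (γ τ)) t) := by
  rw [covDerivAlong, covDerivAlongInChart_eq cov hγ hw hx₀ (mem_chart_source E (γ t)),
    covDerivAlongInChart, coordComponents_add hx₀, coordComponents_coordField hx₀,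
    ← coordComponents_velocity hγ hx₀, christoffel_apply cov hx₀]

/-- The connection operator of `∇` along a curve, in the chart at `x₀`. -/
def curveConnection (cov : AffineConnection E M) (x₀ : M) (γ : ℝ → M) (t : ℝ) : E →L[ℝ] E :=
  (christoffel cov x₀ (extChartAt 𝓘(ℝ, E) x₀ (γ t))).flip
    (deriv (fun τ => extChartAt 𝓘(ℝ, E) x₀ (γ τ)) t)

lemma contDiffOn_curveConnection [T2Space M] (cov : AffineConnection E M)
    [CovariantDerivative.ContMDiffCovariantDerivative cov ∞] {x₀ : M} {γ : ℝ → M} {A : Set ℝ}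
    (hA : IsOpen A) (hγ : ContMDiffOn 𝓘(ℝ, ℝ) 𝓘(ℝ, E) ∞ γ A)
    (hAx : ∀ t ∈ A, γ t ∈ (chartAt E x₀).source) :
    ContDiffOn ℝ ∞ (curveConnection cov x₀ γ) A := by
  have hg := contDiffOn_extChartAt_comp hγ hAx
  have hΓ : ContDiffOn ℝ ∞ (fun t => christoffel cov x₀ (extChartAt 𝓘(ℝ, E) x₀ (γ t))) A :=
    (contDiffOn_christoffel cov x₀).comp hg fun t ht =>
      (extChartAt 𝓘(ℝ, E) x₀).map_source (by simpa using hAx t ht)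
  have hflip : ContDiff ℝ ∞ (ContinuousLinearMap.flipₗᵢ ℝ E E E) :=
    (ContinuousLinearMap.flipₗᵢ ℝ E E E).contDiff
  exact (hflip.comp_contDiffOn hΓ).clm_apply
    ((contDiffOn_infty_iff_deriv_of_isOpen hA).mp hg).2

/-- The iterated covariant derivatives of a curve, in coordinates. -/
lemma coordComponents_iterNabla [T2Space M] (cov : AffineConnection E M)
    [CovariantDerivative.ContMDiffCovariantDerivative cov ∞] {x₀ : M} {γ : ℝ → M} {A : Set ℝ}
    (hA : IsOpen A) (hγ : ContMDiffOn 𝓘(ℝ, ℝ) 𝓘(ℝ, E) ∞ γ A)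
    (hAx : ∀ t ∈ A, γ t ∈ (chartAt E x₀).source) (i : ℕ) :
    ContDiffOn ℝ ∞ (fun t => coordComponents x₀ (iterNabla cov γ (i + 1) t)) A ∧
      ∀ t ∈ A, coordComponents x₀ (iterNabla cov γ (i + 2) t) =
        connDeriv (curveConnection cov x₀ γ)
          (fun t => coordComponents x₀ (iterNabla cov γ (i + 1) t)) t := by
  have hγd : ∀ t ∈ A, MDifferentiableAt 𝓘(ℝ, ℝ) 𝓘(ℝ, E) γ t := fun t ht =>
    (hγ.contMDiffAt (hA.mem_nhds ht)).mdifferentiableAt (by simp)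
  have hrec : ∀ i, ContDiffOn ℝ ∞ (fun t => coordComponents x₀ (iterNabla cov γ (i + 1) t)) A →
      ∀ t ∈ A, coordComponents x₀ (iterNabla cov γ (i + 2) t) =
        connDeriv (curveConnection cov x₀ γ)
          (fun t => coordComponents x₀ (iterNabla cov γ (i + 1) t)) t := fun i hi t ht =>
    coordComponents_covDerivAlong cov (hγd t ht)
      ((hi.differentiableOn (by simp)).differentiableAt (hA.mem_nhds ht)) (hAx t ht)
  suffices h : ContDiffOn ℝ ∞ (fun t => coordComponents x₀ (iterNabla cov γ (i + 1) t)) A from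
    ⟨h, hrec i h⟩
  induction i with
  | zero =>
    exact ((contDiffOn_infty_iff_deriv_of_isOpen hA).mp
      (contDiffOn_extChartAt_comp hγ hAx)).2.congr fun t ht =>
        coordComponents_velocity (hγd t ht) (hAx t ht)
  | succ i ih =>
    exact (contDiffOn_connDeriv hA (contDiffOn_curveConnection cov hA hγ hAx) ih).congr
      (hrec i ih)

end AlongCurves

/-! ### Geodesics -/

section Geodesics

variable {E : Type*} [NormedAddCommGroup E] [NormedSpace ℝ E] [FiniteDimensional ℝ E]
  {M : Type*} [TopologicalSpace M] [T2Space M] [ChartedSpace E M] [IsManifold 𝓘(ℝ, E) ∞ M]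
  (cov : AffineConnection E M) [CovariantDerivative.ContMDiffCovariantDerivative cov ∞]

lemma coordComponents_iterNabla_two {x₀ : M} {c : ℝ → M} {A : Set ℝ}
    (hA : IsOpen A) (hc : ContMDiffOn 𝓘(ℝ, ℝ) 𝓘(ℝ, E) ∞ c A)
    (hAx : ∀ t ∈ A, c t ∈ (chartAt E x₀).source) {t : ℝ} (ht : t ∈ A) :
    coordComponents x₀ (iterNabla cov c 2 t) =
      deriv (deriv fun τ => extChartAt 𝓘(ℝ, E) x₀ (c τ)) t
        + christoffel cov x₀ (extChartAt 𝓘(ℝ, E) x₀ (c t))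
          (deriv (fun τ => extChartAt 𝓘(ℝ, E) x₀ (c τ)) t)
          (deriv (fun τ => extChartAt 𝓘(ℝ, E) x₀ (c τ)) t) := by
  have hvel : ∀ τ ∈ A, coordComponents x₀ (iterNabla cov c 1 τ) =
      deriv (fun τ => extChartAt 𝓘(ℝ, E) x₀ (c τ)) τ := fun τ hτ =>
    coordComponents_velocity
      ((hc.contMDiffAt (hA.mem_nhds hτ)).mdifferentiableAt (by simp)) (hAx τ hτ)
  have hev : (fun τ => coordComponents x₀ (iterNabla cov c 1 τ)) =ᶠ[𝓝 t]
      deriv (fun τ => extChartAt 𝓘(ℝ, E) x₀ (c τ)) :=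
    Filter.eventually_of_mem (hA.mem_nhds ht) hvel
  rw [(coordComponents_iterNabla cov hA hc hAx 0).2 t ht, connDeriv, zero_add, hev.deriv_eq,
    hvel t ht, curveConnection, ContinuousLinearMap.flip_apply]

lemma isOpen_inter_preimage_chart {c : ℝ → M} {J : Set ℝ} (hJ : IsOpen J)
    (hc : ContMDiffOn 𝓘(ℝ, ℝ) 𝓘(ℝ, E) ∞ c J) (x₀ : M) :
    IsOpen (J ∩ c ⁻¹' (chartAt E x₀).source) :=
  hc.continuousOn.isOpen_inter_preimage hJ (chartAt E x₀).open_source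

/-- The coordinate expression of a geodesic is an integral curve of the geodesic spray. -/
lemma IsGeodesicOn.hasDerivAt_spray {c : ℝ → M} {J : Set ℝ} (hJ : IsOpen J)
    (hc : IsGeodesicOn cov c J) {x₀ : M} {t : ℝ} (ht : t ∈ J)
    (hx : c t ∈ (chartAt E x₀).source) :
    HasDerivAt (fun τ => (extChartAt 𝓘(ℝ, E) x₀ (c τ),
        deriv (fun τ => extChartAt 𝓘(ℝ, E) x₀ (c τ)) τ))
      (spray (christoffel cov x₀) (extChartAt 𝓘(ℝ, E) x₀ (c t),
        deriv (fun τ => extChartAt 𝓘(ℝ, E) x₀ (c τ)) t)) t := by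
  have hA := isOpen_inter_preimage_chart hJ hc.1 x₀
  have hcA := hc.1.mono (Set.inter_subset_left (t := c ⁻¹' (chartAt E x₀).source))
  have hAx : ∀ τ ∈ J ∩ c ⁻¹' (chartAt E x₀).source, c τ ∈ (chartAt E x₀).source :=
    fun τ hτ => hτ.2
  have hg := contDiffOn_extChartAt_comp hcA hAx
  have heq := coordComponents_iterNabla_two cov hA hcA hAx ⟨ht, hx⟩
  rw [hc.2 t ht, coordComponents_zero hx, eq_comm, add_eq_zero_iff_eq_neg] at heq
  have h1 := hasDerivAt_of_contDiffOn hA hg ⟨ht, hx⟩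
  have h2 := hasDerivAt_of_contDiffOn hA ((contDiffOn_infty_iff_deriv_of_isOpen hA).mp hg).2
    ⟨ht, hx⟩
  rw [heq] at h2
  exact h1.prodMk h2

/-- The spray is C^1, hence locally Lipschitz, so position and velocity at one time determine the
integral curve nearby; the chart is injective on its domain. -/
lemma IsGeodesicOn.eventuallyEq_of_eq {c₁ c₂ : ℝ → M} {J : Set ℝ} (hJ : IsOpen J)
    (h₁ : IsGeodesicOn cov c₁ J) (h₂ : IsGeodesicOn cov c₂ J) {x₀ : M} {t : ℝ} (ht : t ∈ J)
    (hx : c₁ t ∈ (chartAt E x₀).source) (heq : c₁ t = c₂ t)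
    (hder : deriv (fun τ => extChartAt 𝓘(ℝ, E) x₀ (c₁ τ)) t
      = deriv (fun τ => extChartAt 𝓘(ℝ, E) x₀ (c₂ τ)) t) :
    c₁ =ᶠ[𝓝 t] c₂ := by
  have hx₂ : c₂ t ∈ (chartAt E x₀).source := heq ▸ hx
  have hA₁ := isOpen_inter_preimage_chart hJ h₁.1 x₀
  have hA₂ := isOpen_inter_preimage_chart hJ h₂.1 x₀
  set y : E × E := (extChartAt 𝓘(ℝ, E) x₀ (c₁ t),
    deriv (fun τ => extChartAt 𝓘(ℝ, E) x₀ (c₁ τ)) t) with hy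
  have htgt : y.1 ∈ (extChartAt 𝓘(ℝ, E) x₀).target :=
    (extChartAt 𝓘(ℝ, E) x₀).map_source (by simpa using hx)
  have hX : ContDiffAt ℝ 1 (spray (christoffel cov x₀)) y :=
    ((contDiffOn_spray (contDiffOn_christoffel cov x₀)).contDiffAt
      (((isOpen_extChartAt_target x₀).prod isOpen_univ).mem_nhds
        ⟨htgt, Set.mem_univ _⟩)).of_le (by simp)
  obtain ⟨K, s, hs, hLip⟩ := hX.exists_lipschitzOnWith
  have hd₁ := fun τ (hτ : τ ∈ J ∩ c₁ ⁻¹' (chartAt E x₀).source) =>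
    h₁.hasDerivAt_spray cov hJ hτ.1 hτ.2
  have hd₂ := fun τ (hτ : τ ∈ J ∩ c₂ ⁻¹' (chartAt E x₀).source) =>
    h₂.hasDerivAt_spray cov hJ hτ.1 hτ.2
  have hy₂ : (extChartAt 𝓘(ℝ, E) x₀ (c₂ t),
      deriv (fun τ => extChartAt 𝓘(ℝ, E) x₀ (c₂ τ)) t) = y := by rw [hy, heq, hder]
  have hs₁ := (hd₁ t ⟨ht, hx⟩).continuousAt.eventually_mem hs
  have hs₂ := (hd₂ t ⟨ht, hx₂⟩).continuousAt.eventually_mem (hy₂ ▸ hs)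
  have huniq := ODE_solution_unique_of_eventually
    (v := fun _ => spray (christoffel cov x₀)) (s := fun _ => s) (K := K) (t₀ := t)
    (f := fun τ => (extChartAt 𝓘(ℝ, E) x₀ (c₁ τ),
        deriv (fun τ => extChartAt 𝓘(ℝ, E) x₀ (c₁ τ)) τ))
    (g := fun τ => (extChartAt 𝓘(ℝ, E) x₀ (c₂ τ),
        deriv (fun τ => extChartAt 𝓘(ℝ, E) x₀ (c₂ τ)) τ))
    (Filter.Eventually.of_forall fun _ => hLip)
    (Filter.Eventually.and (Filter.eventually_of_mem (hA₁.mem_nhds ⟨ht, hx⟩) hd₁) hs₁)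
    (Filter.Eventually.and (Filter.eventually_of_mem (hA₂.mem_nhds ⟨ht, hx₂⟩) hd₂) hs₂)
    hy₂.symm
  filter_upwards [huniq, hA₁.mem_nhds ⟨ht, hx⟩, hA₂.mem_nhds ⟨ht, hx₂⟩] with τ hτ hτ₁ hτ₂
  exact (extChartAt 𝓘(ℝ, E) x₀).injOn (by simpa using hτ₁.2) (by simpa using hτ₂.2)
    (congrArg Prod.fst hτ)

/-- Geodesics are determined by their initial point and velocity. -/
lemma IsGeodesicOn.eqOn {c₁ c₂ : ℝ → M} {J : Set ℝ} (hJ : IsOpen J) (hJc : J.OrdConnected)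
    (h0 : (0 : ℝ) ∈ J) (h₁ : IsGeodesicOn cov c₁ J) (h₂ : IsGeodesicOn cov c₂ J)
    (hinit : (⟨c₁ 0, velocity c₁ 0⟩ : TangentBundle 𝓘(ℝ, E) M) = ⟨c₂ 0, velocity c₂ 0⟩) :
    Set.EqOn c₁ c₂ J := by
  have hd₁ : ∀ t ∈ J, MDifferentiableAt 𝓘(ℝ, ℝ) 𝓘(ℝ, E) c₁ t := fun t ht =>
    (h₁.1.contMDiffAt (hJ.mem_nhds ht)).mdifferentiableAt (by simp)
  have hd₂ : ∀ t ∈ J, MDifferentiableAt 𝓘(ℝ, ℝ) 𝓘(ℝ, E) c₂ t := fun t ht =>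
    (h₂.1.contMDiffAt (hJ.mem_nhds ht)).mdifferentiableAt (by simp)
  -- The times near which the germs agree form an open set. It is closed in J because positions (M
  -- being Hausdorff) and velocities agree in the limit, so connectedness of J concludes.
  suffices h : J ⊆ {t | c₁ =ᶠ[𝓝 t] c₂} from fun t ht => (h ht).self_of_nhds
  refine hJc.isPreconnected.subset_of_closure_inter_subset isOpen_setOfPred_eventually_nhds
    ⟨0, h0, ?_⟩ ?_
  · have heq : c₁ 0 = c₂ 0 := congrArg Bundle.TotalSpace.proj hinit
    refine h₁.eventuallyEq_of_eq cov hJ h₂ (x₀ := c₁ 0) h0 (mem_chart_source E _) heq ?_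
    rw [← coordComponents_velocity (hd₁ 0 h0) (mem_chart_source E _),
      ← coordComponents_velocity (hd₂ 0 h0) (heq ▸ mem_chart_source E _)]
    exact congrArg (fun p => (trivializationAt E (TangentSpace 𝓘(ℝ, E) : M → Type _)
      (c₁ 0) p).2) hinit
  · rintro t ⟨htu, ht⟩
    have : (𝓝[{t | c₁ =ᶠ[𝓝 t] c₂}] t).NeBot := mem_closure_iff_nhdsWithin_neBot.mp htu
    have heq : c₁ t = c₂ t := by
      refine tendsto_nhds_unique_of_eventuallyEq (l := 𝓝[{t | c₁ =ᶠ[𝓝 t] c₂}] t)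
        ((hd₁ t ht).continuousAt.tendsto.mono_left nhdsWithin_le_nhds)
        ((hd₂ t ht).continuousAt.tendsto.mono_left nhdsWithin_le_nhds) ?_
      filter_upwards [self_mem_nhdsWithin] with τ hτ
      exact Filter.EventuallyEq.eq_of_nhds hτ
    have hx := mem_chart_source E (c₁ t)
    refine h₁.eventuallyEq_of_eq cov hJ h₂ (x₀ := c₁ t) ht hx heq ?_
    have hc₁ := (h₁.hasDerivAt_spray cov hJ ht hx).continuousAt.snd
    have hc₂ := (h₂.hasDerivAt_spray cov hJ ht (x₀ := c₁ t) (heq ▸ hx)).continuousAt.snd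
    refine tendsto_nhds_unique_of_eventuallyEq (l := 𝓝[{t | c₁ =ᶠ[𝓝 t] c₂}] t)
      (hc₁.tendsto.mono_left nhdsWithin_le_nhds)
      (hc₂.tendsto.mono_left nhdsWithin_le_nhds) ?_
    filter_upwards [self_mem_nhdsWithin] with τ hτ
    exact Filter.EventuallyEq.deriv_eq
      ((show c₁ =ᶠ[𝓝 τ] c₂ from hτ).fun_comp (extChartAt 𝓘(ℝ, E) (c₁ t)))

/-- The choice in the definition is immaterial: two competing geodesics agree on the intersection of
their intervals, which contains 0 and s. -/
lemma geodesicFamily_eq {p : TangentBundle 𝓘(ℝ, E) M} {s : ℝ} {y : M}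
    (h : GeodesicReaches cov p s y) : geodesicFamily cov p s = y := by
  have hex : ∃ y, GeodesicReaches cov p s y := ⟨y, h⟩
  rw [geodesicFamily, dif_pos hex]
  obtain ⟨c₁, J₁, hJ₁, hJc₁, h01, hs1, hg₁, hi₁, hy₁⟩ := hex.choose_spec
  obtain ⟨c₂, J₂, hJ₂, hJc₂, h02, hs2, hg₂, hi₂, hy₂⟩ := h
  rw [← hy₁, ← hy₂]
  refine IsGeodesicOn.eqOn cov (hJ₁.inter hJ₂) (hJc₁.inter hJc₂) ⟨h01, h02⟩
    ⟨hg₁.1.mono Set.inter_subset_left, fun s hs => hg₁.2 s hs.1⟩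
    ⟨hg₂.1.mono Set.inter_subset_right, fun s hs => hg₂.2 s hs.2⟩ (hi₁.trans hi₂.symm)
    ⟨hs1, hs2⟩

lemma contMDiffOn_extChartAt_symm_comp {P : Type*} [NormedAddCommGroup P] [NormedSpace ℝ P]
    {x₀ : M} {S : P → E} {U : Set P} (hS : ContDiffOn ℝ ∞ S U)
    (hU : ∀ q ∈ U, S q ∈ (extChartAt 𝓘(ℝ, E) x₀).target) :
    ContMDiffOn 𝓘(ℝ, P) 𝓘(ℝ, E) ∞ (fun q => (extChartAt 𝓘(ℝ, E) x₀).symm (S q)) U :=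
  (contMDiffOn_extChartAt_symm x₀).comp hS.contMDiffOn hU

/-- A solution of the geodesic equation in coordinates gives a geodesic. -/
lemma geodesicReaches_of_coordinates {x₀ : M} {r : ℝ} (hr : 0 < r) {S V : ℝ → E}
    (hS : ContDiffOn ℝ ∞ S (Set.Ioo (-r) r))
    (hSm : ∀ s ∈ Set.Ioo (-r) r, S s ∈ (extChartAt 𝓘(ℝ, E) x₀).target)
    (hSd : ∀ s ∈ Set.Ioo (-r) r, HasDerivAt S (V s) s)
    (hVd : ∀ s ∈ Set.Ioo (-r) r, HasDerivAt V (-christoffel cov x₀ (S s) (V s) (V s)) s)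
    {p : TangentBundle 𝓘(ℝ, E) M} (hp : p.1 ∈ (chartAt E x₀).source)
    (hp₁ : S 0 = extChartAt 𝓘(ℝ, E) x₀ p.1) (hp₂ : V 0 = coordComponents x₀ p.2)
    {s : ℝ} (hs : s ∈ Set.Ioo (-r) r) :
    GeodesicReaches cov p s ((extChartAt 𝓘(ℝ, E) x₀).symm (S s)) := by
  set c : ℝ → M := fun s => (extChartAt 𝓘(ℝ, E) x₀).symm (S s) with hcdef
  have hc : ContMDiffOn 𝓘(ℝ, ℝ) 𝓘(ℝ, E) ∞ c (Set.Ioo (-r) r) :=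
    contMDiffOn_extChartAt_symm_comp hS hSm
  have hcx : ∀ s ∈ Set.Ioo (-r) r, c s ∈ (chartAt E x₀).source := fun s hs =>
    extChartAt_symm_mem (hSm s hs)
  have hcS : ∀ s ∈ Set.Ioo (-r) r, extChartAt 𝓘(ℝ, E) x₀ (c s) = S s := fun s hs =>
    (extChartAt 𝓘(ℝ, E) x₀).right_inv (hSm s hs)
  have hder : ∀ s ∈ Set.Ioo (-r) r, deriv (fun τ => extChartAt 𝓘(ℝ, E) x₀ (c τ)) s = V s :=
    fun s hs => ((hSd s hs).congr_of_eventuallyEq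
      (Filter.eventually_of_mem (isOpen_Ioo.mem_nhds hs) hcS)).deriv
  have h0 : (0 : ℝ) ∈ Set.Ioo (-r) r := ⟨by linarith, hr⟩
  refine ⟨c, Set.Ioo (-r) r, isOpen_Ioo, Set.ordConnected_Ioo, h0, hs, ⟨hc, fun s hs => ?_⟩, ?_,
    rfl⟩
  · refine coordComponents_injective (hcx s hs) ?_
    rw [coordComponents_zero (hcx s hs), coordComponents_iterNabla_two cov isOpen_Ioo hc hcx hs,
      hder s hs, hcS s hs, ((hVd s hs).congr_of_eventuallyEq
        (Filter.eventually_of_mem (isOpen_Ioo.mem_nhds hs) hder)).deriv, neg_add_cancel]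
  · have hcp : c 0 = p.1 := by
      rw [hcdef]
      simp only [hp₁]
      exact (extChartAt 𝓘(ℝ, E) x₀).left_inv (by simpa using hp)
    have hvel : coordComponents x₀ (velocity c 0) = coordComponents x₀ p.2 := by
      rw [coordComponents_velocity ((hc.contMDiffAt
        (isOpen_Ioo.mem_nhds h0)).mdifferentiableAt (by simp)) (hcx 0 h0), hder 0 h0, hp₂]
    refine (trivializationAt E (TangentSpace 𝓘(ℝ, E) : M → Type _)
      x₀).toOpenPartialHomeomorph.injOn (hcx 0 h0) hp (Prod.ext hcp hvel)

end Geodesics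

/-! ### The tangent surface -/

section Surface

variable {E : Type*} [NormedAddCommGroup E] [NormedSpace ℝ E] [FiniteDimensional ℝ E]
  {M : Type*} [TopologicalSpace M] [T2Space M] [ChartedSpace E M] [IsManifold 𝓘(ℝ, E) ∞ M]

lemma linearIndependent_coordComponents_iff {x₀ x : M} (hx : x ∈ (chartAt E x₀).source)
    (v w : TangentSpace 𝓘(ℝ, E) x) :
    LinearIndependent ℝ ![coordComponents x₀ v, coordComponents x₀ w] ↔
      LinearIndependent ℝ ![v, w] := by
  rw [LinearIndependent.pair_iff, LinearIndependent.pair_iff]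
  have key : ∀ a b : ℝ, a • coordComponents x₀ v + b • coordComponents x₀ w = 0 ↔
      a • v + b • w = 0 := fun a b => by
    rw [← coordComponents_smul hx, ← coordComponents_smul hx, ← coordComponents_add hx]
    exact ⟨fun h => coordComponents_injective hx (h.trans (coordComponents_zero hx).symm),
      fun h => by rw [h, coordComponents_zero hx]⟩
  simp only [key]

/-- Since w ∧ w = 0, the term with a drops out; this identifies the area density with s. -/
lemma ιMulti_pair_add_smul {N : Type*} [AddCommGroup N] [Module ℝ N] (a s : ℝ) (v w : N) :
    ExteriorAlgebra.ιMulti ℝ 2 ![a • w + s • v, w] = s • ExteriorAlgebra.ιMulti ℝ 2 ![v, w] := by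
  simp [ExteriorAlgebra.ιMulti_apply, add_mul]

/-- If the derivative of a map of the plane sends `(ξ₁, ξ₂)` to `ξ₁ (a w + s v) + ξ₂ w` with
linearly independent `v`, `w`, then it is injective if and only if `s ≠ 0`. -/
lemma injective_iff_of_frame {N : Type*} [AddCommGroup N] [Module ℝ N] [TopologicalSpace N]
    {L : (ℝ × ℝ) →L[ℝ] N} {a s : ℝ} {v w : N}
    (hL : ∀ ξ, L ξ = ξ.1 • (a • w + s • v) + ξ.2 • w) (hvw : LinearIndependent ℝ ![v, w]) :
    Function.Injective L ↔ s ≠ 0 := by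
  rw [injective_iff_map_eq_zero]
  constructor
  · rintro h rfl
    -- For s = 0 the kernel is spanned by (1, -a).
    have := h (1, -a) (by rw [hL]; simp)
    simp at this
  · intro hs ξ hξ
    rw [LinearIndependent.pair_iff] at hvw
    obtain ⟨h1, h2⟩ := hvw (ξ.1 * s) (ξ.1 * a + ξ.2) (by rw [← hξ, hL]; module)
    have hξ1 : ξ.1 = 0 := (mul_eq_zero.mp h1).resolve_right hs
    rw [hξ1, zero_mul, zero_add] at h2
    exact Prod.ext hξ1 h2

/-- A map of the plane to `M` with the expression `S` in coordinates, whose derivatives are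
`∂S/∂s = V` and `∂S/∂t = a V + s W` with linearly independent `V` and `W`, is a frontal with the
singular locus `s = 0`, and its singular points are non-degenerate. -/
lemma isFrontal_of_coordinates {f : ℝ × ℝ → M} {x₀ : M} {Q : Set (ℝ × ℝ)} (hQ : IsOpen Q)
    {S V W : ℝ × ℝ → E} {a : ℝ → ℝ} (hS : ContDiffOn ℝ ∞ S Q) (hV : ContDiffOn ℝ ∞ V Q)
    (hW : ContDiffOn ℝ ∞ W Q) (hSm : ∀ q ∈ Q, S q ∈ (extChartAt 𝓘(ℝ, E) x₀).target)
    (hf : ∀ q ∈ Q, f q = (extChartAt 𝓘(ℝ, E) x₀).symm (S q))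
    (hSs : ∀ q ∈ Q, fderiv ℝ S q (0, 1) = V q)
    (hSt : ∀ q ∈ Q, fderiv ℝ S q (1, 0) = a q.1 • V q + q.2 • W q)
    {t₀ : ℝ} (ht₀ : (t₀, (0 : ℝ)) ∈ Q) (hind : LinearIndependent ℝ ![W (t₀, 0), V (t₀, 0)]) :
    IsFrontalWithNondegenerateSingularPointAt (E := E) f (t₀, 0) ∧
      singularLocus (E := E) f =ᶠ[𝓝 (t₀, (0 : ℝ))] {q : ℝ × ℝ | q.2 = 0} := by
  -- Independence is an open condition, so it spreads from (t₀, 0) to a neighbourhood.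
  set U : Set (ℝ × ℝ) := Q ∩ (fun q => ![W q, V q]) ⁻¹' {b | LinearIndependent ℝ b} with hUdef
  have hcont : ContinuousOn (fun q => ![W q, V q]) Q := by
    refine continuousOn_pi.mpr fun i => ?_
    fin_cases i
    exacts [hW.continuousOn, hV.continuousOn]
  have hU : IsOpen U := hcont.isOpen_inter_preimage hQ isOpen_setOfPred_linearIndependent
  have hUQ : U ⊆ Q := Set.inter_subset_left
  have htU : (t₀, (0 : ℝ)) ∈ U := ⟨ht₀, hind⟩
  have hfx : ∀ q ∈ Q, f q ∈ (chartAt E x₀).source := fun q hq => by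
    rw [hf q hq]
    exact extChartAt_symm_mem (hSm q hq)
  have hfsmooth : ContMDiffOn 𝓘(ℝ, ℝ × ℝ) 𝓘(ℝ, E) ∞ f Q :=
    (contMDiffOn_extChartAt_symm_comp hS hSm).congr hf
  have hfS : ∀ q ∈ Q, extChartAt 𝓘(ℝ, E) x₀ (f q) = S q := fun q hq => by
    rw [hf q hq, (extChartAt 𝓘(ℝ, E) x₀).right_inv (hSm q hq)]
  set V₁ : ∀ q : ℝ × ℝ, TangentSpace 𝓘(ℝ, E) (f q) := fun q => coordField x₀ (W q) (f q)
  set V₂ : ∀ q : ℝ × ℝ, TangentSpace 𝓘(ℝ, E) (f q) := fun q => coordField x₀ (V q) (f q)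
  have hV₁ : ∀ q ∈ Q, coordComponents x₀ (V₁ q) = W q := fun q hq =>
    coordComponents_coordField (hfx q hq) _
  have hV₂ : ∀ q ∈ Q, coordComponents x₀ (V₂ q) = V q := fun q hq =>
    coordComponents_coordField (hfx q hq) _
  have hderiv : ∀ q ∈ Q, ∀ ξ : ℝ × ℝ, surfaceDeriv f q ξ =
      ξ.1 • (a q.1 • V₂ q + q.2 • V₁ q) + ξ.2 • V₂ q := by
    intro q hq ξ
    have hx := hfx q hq
    refine coordComponents_injective hx ?_
    simp only [coordComponents_add hx, coordComponents_smul hx, hV₁ q hq, hV₂ q hq]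
    have hsd : coordComponents x₀ (surfaceDeriv f q ξ) =
        fderiv ℝ (fun p => extChartAt 𝓘(ℝ, E) x₀ (f p)) q ξ :=
      coordComponents_mfderiv
        ((hfsmooth.contMDiffAt (hQ.mem_nhds hq)).mdifferentiableAt (by simp)) hx ξ
    rw [hsd, Filter.EventuallyEq.fderiv_eq (Filter.eventually_of_mem (hQ.mem_nhds hq) hfS),
      ← hSt q hq, ← hSs q hq, ← map_smul, ← map_smul, ← map_add]
    simp
  have hlin : ∀ q ∈ U, LinearIndependent ℝ ![V₁ q, V₂ q] := fun q hq => by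
    rw [← linearIndependent_coordComponents_iff (hfx q (hUQ hq)), hV₁ q (hUQ hq),
      hV₂ q (hUQ hq)]
    exact hq.2
  refine ⟨⟨U, hU, htU, hfsmooth.mono hUQ, V₁, V₂, ⟨?_, ?_, hlin, ?_⟩, Prod.snd,
    contDiff_snd.contDiffOn, ?_, rfl, ?_⟩, ?_⟩
  · exact (contMDiffOn_tangentBundle_iff fun q hq => hfx q (hUQ hq)).mpr
      ⟨hfsmooth.mono hUQ, (hW.mono hUQ).congr fun q hq => hV₁ q (hUQ hq)⟩
  · exact (contMDiffOn_tangentBundle_iff fun q hq => hfx q (hUQ hq)).mpr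
      ⟨hfsmooth.mono hUQ, (hV.mono hUQ).congr fun q hq => hV₂ q (hUQ hq)⟩
  · intro q hq ξ
    rw [Submodule.mem_span_pair]
    refine ⟨ξ.1 * q.2, ξ.1 * a q.1 + ξ.2, ?_⟩
    rw [hderiv q (hUQ hq)]
    module
  · intro q hq
    rw [hderiv q (hUQ hq), hderiv q (hUQ hq)]
    simpa using ιMulti_pair_add_smul (a q.1) q.2 (V₁ q) (V₂ q)
  · intro h
    have := congrArg (fun L : (ℝ × ℝ) →L[ℝ] ℝ => L (0, 1)) h
    simp [fderiv_snd] at this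
  · filter_upwards [hU.mem_nhds htU] with q hq
    refine propext ?_
    change ¬ Function.Injective (surfaceDeriv (E := E) f q) ↔ q.2 = 0
    rw [injective_iff_of_frame (hderiv q (hUQ hq)) (hlin q hq), not_not]

end Surface

/-! ### The frame of the curve and the main theorem -/

section Main

variable {E : Type*} [NormedAddCommGroup E] [NormedSpace ℝ E] [FiniteDimensional ℝ E]
  {M : Type*} [TopologicalSpace M] [T2Space M] [ChartedSpace E M] [IsManifold 𝓘(ℝ, E) ∞ M]
  (cov : AffineConnection E M) [CovariantDerivative.ContMDiffCovariantDerivative cov ∞]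

/-- In coordinates, the velocity of a curve satisfying the hypotheses on the iterated covariant
derivatives is `(t - t₀)^m v`, where `v` is linearly independent of its covariant derivative at
`t₀`. -/
lemma exists_velocity_eq_pow_smul {γ : ℝ → M} {x₀ : M} {t₀ r : ℝ} (hr : 0 < r)
    (hγ : ContMDiffOn 𝓘(ℝ, ℝ) 𝓘(ℝ, E) ∞ γ (Set.Ioo (t₀ - r) (t₀ + r)))
    (hx : ∀ t ∈ Set.Ioo (t₀ - r) (t₀ + r), γ t ∈ (chartAt E x₀).source) {m : ℕ}
    (hzero : ∀ i < m, iterNabla cov γ (i + 1) t₀ = 0)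
    (hindep : LinearIndependent ℝ ![iterNabla cov γ (m + 1) t₀, iterNabla cov γ (m + 2) t₀]) :
    ∃ v : ℝ → E, ContDiffOn ℝ ∞ v (Set.Ioo (t₀ - r) (t₀ + r)) ∧
      (∀ t ∈ Set.Ioo (t₀ - r) (t₀ + r),
        coordComponents x₀ (velocity γ t) = (t - t₀) ^ m • v t) ∧
      LinearIndependent ℝ ![v t₀, connDeriv (curveConnection cov x₀ γ) v t₀] := by
  have ht₀ : t₀ ∈ Set.Ioo (t₀ - r) (t₀ + r) := ⟨by linarith, by linarith⟩
  have hB := contDiffOn_curveConnection cov isOpen_Ioo hγ hx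
  have hrec := coordComponents_iterNabla cov isOpen_Ioo hγ hx
  -- The index is shifted so that W 0 is the velocity; `iterNabla` starts effectively at 1.
  set W : ℕ → ℝ → E := fun i t => coordComponents x₀ (iterNabla cov γ (i + 1) t) with hWdef
  have hW : ∀ i, ∀ t ∈ Set.Ioo (t₀ - r) (t₀ + r),
      W (i + 1) t = connDeriv (curveConnection cov x₀ γ) (W i) t := fun i => (hrec i).2
  obtain ⟨v, hv, hWv⟩ := exists_eq_pow_smul_of_iterate_eq_zero hr hB (W := W) (hrec 0).1 hW m
    fun i hi => by
      rw [hWdef]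
      simp only [hzero i hi]
      exact coordComponents_zero (hx t₀ ht₀)
  refine ⟨v, hv, hWv, ?_⟩
  obtain ⟨c, c', hc, hc', h1, h2⟩ := exists_iterate_connDeriv_eq_at isOpen_Ioo ht₀ hB hv hW hWv
  rw [← linearIndependent_coordComponents_iff (hx t₀ ht₀)] at hindep
  change LinearIndependent ℝ ![W m t₀, W (m + 1) t₀] at hindep
  rw [h1, h2, LinearIndependent.pair_iff] at hindep
  rw [LinearIndependent.pair_iff]
  intro a b hab
  obtain ⟨h3, h4⟩ := hindep (a / c) (b / c') (by
    rwa [smul_smul, smul_smul, div_mul_cancel₀ _ hc.ne', div_mul_cancel₀ _ hc'.ne'])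
  exact ⟨by simpa [hc.ne'] using h3, by simpa [hc'.ne'] using h4⟩

/-- The field with components v is itself a frame as long as v does not vanish, with the factor (t -
t₀)^m. -/
lemma exists_directedFrame {γ : ℝ → M} {x₀ : M} {A : Set ℝ} (hA : IsOpen A) {t₀ : ℝ}
    (ht₀ : t₀ ∈ A) (hγ : ContMDiffOn 𝓘(ℝ, ℝ) 𝓘(ℝ, E) ∞ γ A)
    (hx : ∀ t ∈ A, γ t ∈ (chartAt E x₀).source) {m : ℕ} {v : ℝ → E}
    (hv : ContDiffOn ℝ ∞ v A) (hv0 : v t₀ ≠ 0)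
    (hvel : ∀ t ∈ A, coordComponents x₀ (velocity γ t) = (t - t₀) ^ m • v t) :
    ∃ J : Set ℝ, IsOpen J ∧ J.OrdConnected ∧ t₀ ∈ J ∧ J ⊆ A ∧
      ∃ u : ∀ t : ℝ, TangentSpace 𝓘(ℝ, E) (γ t), IsDirectedFrameOn γ u J := by
  have hopen : IsOpen (A ∩ v ⁻¹' {0}ᶜ) :=
    hv.continuousOn.isOpen_inter_preimage hA isOpen_compl_singleton
  obtain ⟨δ, hδ, hsub⟩ := Metric.isOpen_iff.mp hopen t₀ ⟨ht₀, hv0⟩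
  rw [Real.ball_eq_Ioo] at hsub
  have hcomp : ∀ t ∈ A, coordComponents x₀ (coordField x₀ (v t) (γ t)) = v t := fun t ht =>
    coordComponents_coordField (hx t ht) _
  refine ⟨Set.Ioo (t₀ - δ) (t₀ + δ), isOpen_Ioo, Set.ordConnected_Ioo,
    ⟨by linarith, by linarith⟩, fun t ht => (hsub ht).1, fun t => coordField x₀ (v t) (γ t),
    ?_, ?_, ?_⟩
  · exact (contMDiffOn_tangentBundle_iff fun t ht => hx t (hsub ht).1).mpr
      ⟨hγ.mono fun t ht => (hsub ht).1,
        (hv.mono fun t ht => (hsub ht).1).congr fun t ht => hcomp t (hsub ht).1⟩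
  · intro t ht h0
    apply (hsub ht).2
    have := hcomp t (hsub ht).1
    rw [h0, coordComponents_zero (hx t (hsub ht).1)] at this
    exact this.symm
  · intro t ht
    refine ⟨(t - t₀) ^ m, coordComponents_injective (hx t (hsub ht).1) ?_⟩
    rw [coordComponents_smul (hx t (hsub ht).1), hcomp t (hsub ht).1, hvel t (hsub ht).1]

/-- Independence passes from v to the given frame u, after which the coordinate surface applies;
uniqueness of geodesics identifies it with `tangentSurface`. -/
lemma isFrontal_tangentSurface {γ : ℝ → M} {x₀ : M} {A : Set ℝ} (hA : IsOpen A) {t₀ : ℝ}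
    (ht₀ : t₀ ∈ A) (hγ : ContMDiffOn 𝓘(ℝ, ℝ) 𝓘(ℝ, E) ∞ γ A)
    (hx : ∀ t ∈ A, γ t ∈ (chartAt E x₀).source) {m : ℕ} {v : ℝ → E}
    (hv : ContDiffOn ℝ ∞ v A)
    (hvel : ∀ t ∈ A, coordComponents x₀ (velocity γ t) = (t - t₀) ^ m • v t)
    (hind : LinearIndependent ℝ ![v t₀, connDeriv (curveConnection cov x₀ γ) v t₀])
    {u : ∀ t : ℝ, TangentSpace 𝓘(ℝ, E) (γ t)} (hu : IsDirectedFrameOn γ u A) :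
    IsFrontalWithNondegenerateSingularPointAt (E := E) (tangentSurface cov γ u) (t₀, 0) ∧
      singularLocus (E := E) (tangentSurface cov γ u)
        =ᶠ[𝓝 (t₀, (0 : ℝ))] {q : ℝ × ℝ | q.2 = 0} := by
  have huc := ((contMDiffOn_tangentBundle_iff hx).mp hu.smooth).2
  have hu0 : coordComponents x₀ (u t₀) ≠ 0 := fun h =>
    hu.ne_zero t₀ ht₀ (coordComponents_injective (hx t₀ ht₀)
      (h.trans (coordComponents_zero (hx t₀ ht₀)).symm))
  obtain ⟨A₁, hA₁A, hA₁, ht₁, a, ha, hau, hind'⟩ := exists_smooth_factor_of_proportional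
    (w := fun t => coordComponents x₀ (velocity γ t)) (B := curveConnection cov x₀ γ)
    hA ht₀ huc hv hvel hu0 (fun t ht => by
      obtain ⟨b, hb⟩ := hu.integral t ht
      exact ⟨b, by rw [hb, coordComponents_smul (hx t ht)]⟩) hind
  have hg := contDiffOn_extChartAt_comp hγ hx
  have hγd : ∀ t ∈ A, coordComponents x₀ (velocity γ t) =
      deriv (fun τ => extChartAt 𝓘(ℝ, E) x₀ (γ τ)) t := fun t ht =>
    coordComponents_velocity ((hγ.contMDiffAt (hA.mem_nhds ht)).mdifferentiableAt (by simp))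
      (hx t ht)
  obtain ⟨A₂, hA₂A₁, hA₂, ht₂, r, hr, S, V, W, hS, hV, hW, hinit, hmain, hindW⟩ :=
    exists_coordinate_tangentSurface (isOpen_extChartAt_target x₀)
      (contDiffOn_christoffel cov x₀) hA₁ ht₁ (hg.mono hA₁A)
      (fun t ht => (extChartAt 𝓘(ℝ, E) x₀).map_source (by simpa using hx t (hA₁A ht)))
      (huc.mono hA₁A) ha (fun t ht => by rw [← hau t ht, hγd t (hA₁A ht)]) hind'
  refine isFrontal_of_coordinates (hA₂.prod isOpen_Ioo) hS hV hW (fun q hq => (hmain q hq).1) ?_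
    (fun q hq => (hmain q hq).2.2.2.1) (fun q hq => (hmain q hq).2.2.2.2)
    ⟨ht₂, by linarith, hr⟩ hindW
  intro q hq
  have hqs : ∀ s ∈ Set.Ioo (-r) r, (q.1, s) ∈ A₂ ×ˢ Set.Ioo (-r) r := fun s hs => ⟨hq.1, hs⟩
  exact geodesicFamily_eq cov (geodesicReaches_of_coordinates cov hr
    (S := fun s => S (q.1, s)) (V := fun s => V (q.1, s))
    (hS.comp (by fun_prop) hqs) (fun s hs => (hmain _ (hqs s hs)).1)
    (fun s hs => (hmain _ (hqs s hs)).2.1) (fun s hs => (hmain _ (hqs s hs)).2.2.1)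
    (p := ⟨γ q.1, u q.1⟩) (hx q.1 (hA₁A (hA₂A₁ hq.1))) (hinit q.1 hq.1).1 (hinit q.1 hq.1).2
    hq.2)

end Main

end TangentSurface

end

theorem lemma2p2 {E : Type*} [NormedAddCommGroup E] [NormedSpace ℝ E] [FiniteDimensional ℝ E]
    {M : Type*} [TopologicalSpace M] [T2Space M] [ChartedSpace E M] [IsManifold 𝓘(ℝ, E) ∞ M]
    (cov : TangentSurface.AffineConnection E M) [CovariantDerivative.ContMDiffCovariantDerivative cov ∞]
    (I : Set ℝ) (hIopen : IsOpen I) (hI : I.OrdConnected)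
    (γ : ℝ → M) (hγ : ContMDiffOn 𝓘(ℝ, ℝ) 𝓘(ℝ, E) ∞ γ I)
    (t₀ : ℝ) (ht₀ : t₀ ∈ I) (k : ℕ) (hk : 1 ≤ k)
    (hzero : ∀ i : ℕ, 1 ≤ i → i < k → TangentSurface.iterNabla cov γ i t₀ = 0)
    (hindep : LinearIndependent ℝ
      ![TangentSurface.iterNabla cov γ k t₀, TangentSurface.iterNabla cov γ (k + 1) t₀]) :
    -- `γ` is directed near `t₀`, so that its tangent surface is defined as a germ at `(t₀, 0)`
    (∃ J : Set ℝ, IsOpen J ∧ J.OrdConnected ∧ t₀ ∈ J ∧ J ⊆ I ∧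
      ∃ u : ∀ t : ℝ, TangentSpace 𝓘(ℝ, E) (γ t), TangentSurface.IsDirectedFrameOn γ u J) ∧
    -- and whatever frame is used to define it, the germ has the asserted properties
    (∀ J : Set ℝ, IsOpen J → t₀ ∈ J → J ⊆ I →
      ∀ u : ∀ t : ℝ, TangentSpace 𝓘(ℝ, E) (γ t), TangentSurface.IsDirectedFrameOn γ u J →
        TangentSurface.IsFrontalWithNondegenerateSingularPointAt (E := E)
          (TangentSurface.tangentSurface cov γ u) (t₀, 0) ∧
        TangentSurface.singularLocus (E := E) (TangentSurface.tangentSurface cov γ u)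
          =ᶠ[𝓝 (t₀, (0 : ℝ))] {q : ℝ × ℝ | q.2 = 0}) := by
  -- Here m is the order of vanishing of γ' at `t₀`.
  obtain ⟨m, rfl⟩ : ∃ m, k = m + 1 := ⟨k - 1, by omega⟩
  obtain ⟨r, hr, hsub⟩ := Metric.isOpen_iff.mp
    (TangentSurface.isOpen_inter_preimage_chart hIopen hγ (γ t₀)) t₀
    ⟨ht₀, mem_chart_source E (γ t₀)⟩
  rw [Real.ball_eq_Ioo] at hsub
  have ht₀r : t₀ ∈ Set.Ioo (t₀ - r) (t₀ + r) := ⟨by linarith, by linarith⟩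
  have hγr := hγ.mono fun t ht => (hsub ht).1
  have hx : ∀ t ∈ Set.Ioo (t₀ - r) (t₀ + r), γ t ∈ (chartAt E (γ t₀)).source :=
    fun t ht => (hsub ht).2
  obtain ⟨v, hv, hvel, hind⟩ := TangentSurface.exists_velocity_eq_pow_smul cov hr hγr hx
    (m := m) (fun i hi => hzero (i + 1) (by omega) (by omega)) hindep
  refine ⟨?_, fun J hJ htJ _ u hu => ?_⟩
  · obtain ⟨J, hJ, hJc, htJ, hJA, hu⟩ := TangentSurface.exists_directedFrame isOpen_Ioo ht₀r
      hγr hx hv (hind.ne_zero 0) hvel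
    exact ⟨J, hJ, hJc, htJ, fun t ht => (hsub (hJA ht)).1, hu⟩
  -- The field v and the frame u are both available on this open set; it need not be an interval,
  -- since the division by t - t₀ is already done.
  · have hl : Set.Ioo (t₀ - r) (t₀ + r) ∩ J ⊆ Set.Ioo (t₀ - r) (t₀ + r) :=
      Set.inter_subset_left
    have hr' : Set.Ioo (t₀ - r) (t₀ + r) ∩ J ⊆ J := Set.inter_subset_right
    exact TangentSurface.isFrontal_tangentSurface cov (isOpen_Ioo.inter hJ) ⟨ht₀r, htJ⟩
      (hγr.mono hl) (fun t ht => hx t (hl ht)) (hv.mono hl) (fun t ht => hvel t (hl ht)) hind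
      ⟨hu.smooth.mono hr', fun t ht => hu.ne_zero t (hr' ht),
        fun t ht => hu.integral t (hr' ht)⟩
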